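/- Let $k$ be a commutative Artin ring and let $\Lambda$ be an Artin $k$-algebra, that is, a $k$-algebra that is finitely generated as a $k$-module (for instance $k=Z(\Lambda)$). Let $\mathfrak r$ be the Jacobson radical of $\Lambda$, let $\operatorname{mod}\Lambda$ be the category of finitely generated left $\Lambda$-modules, let $D^b(\Lambda)$ be the bounded derived category of $\operatorname{mod}\Lambda$, and let $\operatorname{id}\Lambda$ be the injective dimension of $\Lambda$ as a left module over itself. Let $\underline{\operatorname{mod}}\,\Lambda$ be the stable category, obtained from $\operatorname{mod}\Lambda$ by factoring out the morphisms that factor through projective modules. On it let $\Sigma$ be the functor given by cokernels of left $\operatorname{add}\Lambda$-approximations, let $\Omega$ be the syzygy functor, and put $\Sigma^{d}=\Omega^{-d}$ for $d<0$. Let $\underline{\operatorname{MCM}}(\Lambda)\subseteq\underline{\operatorname{mod}}\,\Lambda$ be the full subcategory of maximal Cohen–Macaulay modules, i.e. of those $M$ with $\operatorname{Ext}^i_\Lambda(M,\Lambda)=0$ for all $i>0$. (When $\Lambda$ is Gorenstein, i.e. has finite injective dimension on both sides, $\underline{\operatorname{MCM}}(\Lambda)$ is triangulated with suspension $\Sigma$,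 whose inverse is $\Omega$.) Let $D=\operatorname{Hom}_k(-,E)$, where $E$ is a $k$-module into which every simple $k$-module embeds (for instance $E=k$, or $E$ an injective envelope of $k/\operatorname{rad}k$). Suppose that $\Lambda$ is stably symmetric, i.e. that $\underline{\operatorname{MCM}}(\Lambda)$ is weakly $d$-Calabi–Yau for some $d\in\mathbb Z$: there is a $k$-linear equivalence $S$ of $\underline{\operatorname{MCM}}(\Lambda)$ with itself, isomorphic as a functor to $\Sigma^d$, together with $k$-linear isomorphisms $\operatorname{Hom}(X,Y)\simeq D\operatorname{Hom}(Y,SX)$ that are functorial in $X$ and $Y$. Let $R=\bigoplus_{i\ge 0}R_i$ be a graded-commutative ring ($rs=(-1)^{|r||s|}sr$ for homogeneous $r,s$) acting centrally on $D^b(\Lambda)$, i.e. equipped with a homomorphism of graded rings to the graded center of $D^b(\Lambda)$, whose degree $n$ part consists of the natural transformations $f\colon\mathrm{Id}\to\Sigma^n$ with $f_{\Sigma X}=(-1)^n\Sigma f_X$ (here $\Sigma$ is the suspension of $D^b(\Lambda)$). Suppose that $\operatorname{Ext}^*_\Lambda(\Lambda/\mathfrak r,\Lambda/\mathfrak r)=\bigoplus_{i}\operatorname{Hom}_{D^b(\Lambda)}(\Lambda/\mathfrak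 r,\Sigma^i(\Lambda/\mathfrak r))$ is eventually Noetherian of finite length over $R$: there is an $n_0$ such that $\operatorname{Ext}^{\ge n_0}_\Lambda(\Lambda/\mathfrak r,\Lambda/\mathfrak r)$ is a Noetherian $R$-module, and $\operatorname{Ext}^n_\Lambda(\Lambda/\mathfrak r,\Lambda/\mathfrak r)$ has finite length over $R_0$ for all $n\ge n_0$. Then for all $M,N\in\operatorname{mod}\Lambda$ the following are equivalent: (i) $\operatorname{Ext}^i_\Lambda(M,N)=0$ for $i\gg 0$; (ii) $\operatorname{Ext}^i_\Lambda(M,N)=0$ for all $i>\operatorname{id}\Lambda$; (iii) $\operatorname{Ext}^i_\Lambda(N,M)=0$ for $i\gg 0$; (iv) $\operatorname{Ext}^i_\Lambda(N,M)=0$ for all $i>\operatorname{id}\Lambda$. -/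

import Mathlib

open CategoryTheory CategoryTheory.Abelian DirectSum

universe w u

/-! ### Central actions of graded-commutative rings -/

section CentralAction

variable {R : Type*} [Ring R]

/-- `R = ⨁ 𝒜 n` is graded-commutative: `r s = (-1)^{|r||s|} s r` for homogeneous `r`, `s`. -/
def IsGradedCommutative (𝒜 : ℕ → AddSubgroup R) : Prop :=
  ∀ ⦃m n : ℕ⦄ ⦃r s : R⦄, r ∈ 𝒜 m → s ∈ 𝒜 n → r * s = (-1) ^ (m * n) * (s * r)

variable (T : Type*) [Category T] [Preadditive T] [HasShift T ℤ]
  [∀ n : ℤ, (shiftFunctor T n).Additive]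

/-- The degree `n` component `Zⁿ(T)` of the graded center of `T`: natural transformations
`f : Id ⟶ Σⁿ` with `f_{ΣX} = (-1)ⁿ Σ f_X`, where `ΣΣⁿX` and `ΣⁿΣX` are identified through the
canonical isomorphism. -/
def gradedCenter (n : ℤ) : AddSubgroup (𝟭 T ⟶ shiftFunctor T n) where
  carrier := {f | ∀ X : T, f.app (X⟦(1 : ℤ)⟧) =
    n.negOnePow • ((f.app X)⟦(1 : ℤ)⟧' ≫ (shiftComm X n (1 : ℤ)).hom)}
  zero_mem' X := by simp
  add_mem' {f g} hf hg X := by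
    have h1 := hf X
    have h2 := hg X
    rw [NatTrans.app_add, NatTrans.app_add, h1, h2, Functor.map_add, Preadditive.add_comp,
      smul_add]
  neg_mem' {f} hf X := by
    have h1 := hf X
    rw [NatTrans.app_neg, NatTrans.app_neg, h1, Functor.map_neg, Preadditive.neg_comp, smul_neg]

/-- The component at `X` of a degree `n` element of the graded center, as an element of
`Hom(X, ΣⁿX)`. -/
abbrev centerApp {T : Type*} [Category T] [Preadditive T] [HasShift T ℤ]
    [∀ n : ℤ, (shiftFunctor T n).Additive] {n : ℤ} (f : gradedCenter T n) (X : T) :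
    ShiftedHom X X n :=
  f.1.app X

/-- A central action of the graded ring `R = ⨁ 𝒜 n` on `T`: a homomorphism of graded rings from
`R` to the graded center of `T`. The product of `f : Id ⟶ Σᵐ` and `g : Id ⟶ Σⁿ` in the graded
center is `X ⟶ ΣⁿX ⟶ Σᵐ⁺ⁿX`, first `g_X` and then `Σⁿ f_X`. -/
structure CentralAction (𝒜 : ℕ → AddSubgroup R) [GradedRing 𝒜] where
  /-- The degree `n` part of the homomorphism. -/
  toCenter (n : ℕ) : 𝒜 n →+ gradedCenter T (n : ℤ)
  map_one (X : T) : centerApp (toCenter 0 ⟨1, SetLike.GradedOne.one_mem⟩) X =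
    ShiftedHom.mk₀ _ Nat.cast_zero (𝟙 X)
  map_mul {m n : ℕ} (r : 𝒜 m) (s : 𝒜 n) (X : T) :
    centerApp (toCenter (m + n) ⟨r.1 * s.1, SetLike.GradedMul.mul_mem r.2 s.2⟩) X =
      (centerApp (toCenter n s) X).comp (centerApp (toCenter m r) X) (Nat.cast_add m n).symm

namespace CentralAction

variable {T} {𝒜 : ℕ → AddSubgroup R} [GradedRing 𝒜] (act : CentralAction T 𝒜)

/-- The graded group `Hom*(X, Y) = ⨁_{i ∈ ℤ} Hom(X, Σⁱ Y)`, on which `R` acts through `act`. -/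
def HomStar (_act : CentralAction T 𝒜) (X Y : T) : Type _ :=
  ⨁ i : ℤ, ShiftedHom X Y i

noncomputable instance (X Y : T) : AddCommGroup (act.HomStar X Y) :=
  inferInstanceAs (AddCommGroup (⨁ i : ℤ, ShiftedHom X Y i))

variable {X Y : T}

/-- The homogeneous component of degree `i` of an element of `Hom*(X, Y)`. -/
def HomStar.coeff (x : act.HomStar X Y) (i : ℤ) : ShiftedHom X Y i :=
  (show ⨁ i : ℤ, ShiftedHom X Y i from x) i

variable (X Y) in
/-- A homogeneous element `r` of degree `n` acts on `Hom*(X, Y)` by sending `g : X ⟶ ΣᵐY` to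
`X ⟶ ΣᵐY ⟶ Σⁿ⁺ᵐY`, the second map being `Σᵐ φ_Y(r)`. -/
noncomputable def actBy (n : ℕ) (r : 𝒜 n) :
    (⨁ i : ℤ, ShiftedHom X Y i) →+ (⨁ i : ℤ, ShiftedHom X Y i) :=
  DirectSum.toAddMonoid fun m =>
    (DirectSum.of (fun i : ℤ => ShiftedHom X Y i) ((n : ℤ) + m)).comp
      (AddMonoidHom.mk' (fun g : ShiftedHom X Y m => g.comp (centerApp (act.toCenter n r) Y) rfl)
        (fun g h => ShiftedHom.add_comp g h _ rfl))

variable (X Y) in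
/-- The action of the homogeneous elements of degree `n`, as an additive map. -/
noncomputable def homogeneousAct (n : ℕ) : 𝒜 n →+ AddMonoid.End (⨁ i : ℤ, ShiftedHom X Y i) :=
  AddMonoidHom.mk' (act.actBy X Y n) (fun r s => by
    refine DirectSum.addHom_ext fun m g => ?_
    change act.actBy X Y n (r + s) _ = act.actBy X Y n r (DirectSum.of _ m g) +
      act.actBy X Y n s (DirectSum.of _ m g)
    simp only [actBy]
    rw [toAddMonoid_of, toAddMonoid_of, toAddMonoid_of]
    simp only [AddMonoidHom.comp_apply, AddMonoidHom.mk'_apply]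
    rw [← AddMonoidHom.map_add, ← ShiftedHom.comp_add, _root_.map_add]
    rfl)

lemma homogeneousAct_of (n : ℕ) (r : 𝒜 n) {m c : ℤ} (g : ShiftedHom X Y m) (h : (n : ℤ) + m = c) :
    act.homogeneousAct X Y n r (DirectSum.of (fun i : ℤ => ShiftedHom X Y i) m g) =
      DirectSum.of (fun i : ℤ => ShiftedHom X Y i) c (g.comp (centerApp (act.toCenter n r) Y) h) := by
  subst h
  exact toAddMonoid_of _ _ _

lemma homogeneousAct_apply (n : ℕ) (r : 𝒜 n) (x : ⨁ i : ℤ, ShiftedHom X Y i) {i j : ℤ}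
    (h : (n : ℤ) + i = j) :
    (act.homogeneousAct X Y n r x) j = (x i).comp (centerApp (act.toCenter n r) Y) h := by
  induction x using DirectSum.induction_on with
  | zero => simp
  | of m g =>
    rw [act.homogeneousAct_of n r g rfl]
    by_cases hm : m = i
    · subst hm
      subst h
      rw [of_eq_same, of_eq_same]
    · rw [of_eq_of_ne _ _ _ (by omega), of_eq_of_ne _ _ _ (by omega), ShiftedHom.zero_comp]
  | add x y hx hy => rw [_root_.map_add, DirectSum.add_apply, DirectSum.add_apply, hx, hy, ShiftedHom.add_comp]

variable (X Y) in
/-- The action of `R` on `Hom*(X, Y)` as a ring homomorphism. -/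
noncomputable def toEnd : R →+* AddMonoid.End (⨁ i : ℤ, ShiftedHom X Y i) :=
  (DirectSum.toSemiring (act.homogeneousAct X Y)
    (by
      refine DirectSum.addHom_ext fun m g => ?_
      have := act.homogeneousAct_of 0 ⟨1, SetLike.GradedOne.one_mem⟩ g
        (show ((0 : ℕ) : ℤ) + m = m by simp)
      rw [act.map_one, ShiftedHom.comp_mk₀_id] at this
      exact this)
    (by
      intro i j r s
      refine DirectSum.addHom_ext fun m g => ?_
      have h1 := act.homogeneousAct_of (i + j)
        ⟨r.1 * s.1, SetLike.GradedMul.mul_mem r.2 s.2⟩ g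
        (show ((i + j : ℕ) : ℤ) + m = (i : ℤ) + ((j : ℤ) + m) by push_cast; ring)
      rw [act.map_mul] at h1
      refine h1.trans ?_
      change _ = act.homogeneousAct X Y i r 
        (act.homogeneousAct X Y j s (DirectSum.of (fun i : ℤ => ShiftedHom X Y i) m g))
      rw [act.homogeneousAct_of j s g rfl, act.homogeneousAct_of i r _ rfl]
      congr 1
      exact (ShiftedHom.comp_assoc g _ _ rfl _ (by ring)).symm)).comp
    (DirectSum.decomposeRingEquiv 𝒜).toRingHom

noncomputable instance : Module R (act.HomStar X Y) :=
  letI : Module (AddMonoid.End (⨁ i : ℤ, ShiftedHom X Y i)) (act.HomStar X Y) :=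
    inferInstanceAs (Module (AddMonoid.End (⨁ i : ℤ, ShiftedHom X Y i))
      (⨁ i : ℤ, ShiftedHom X Y i))
  Module.compHom _ (act.toEnd X Y)

/-- A homogeneous `r` of degree `n` acts by `(r • x)ₙ₊ᵢ = Σⁱφ_Y(r) ∘ xᵢ`. -/
lemma HomStar.coeff_smul (n : ℕ) (r : 𝒜 n) (x : act.HomStar X Y) {i j : ℤ} (h : (n : ℤ) + i = j) :
    (r.1 • x).coeff act j = (x.coeff act i).comp (centerApp (act.toCenter n r) Y) h := by
  have h1 : act.toEnd X Y r.1 = act.homogeneousAct X Y n r := by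
    change DirectSum.toAddMonoid (act.homogeneousAct X Y) (DirectSum.decompose 𝒜 r.1) = _
    rw [DirectSum.decompose_coe, DirectSum.toAddMonoid_of]
  change (act.toEnd X Y r.1 (show ⨁ i : ℤ, ShiftedHom X Y i from x)) j = _
  rw [h1]
  exact act.homogeneousAct_apply n r _ h

variable (X Y)

/-- The `R`-submodule `Hom^{≥ n₀}(X, Y)` of `Hom*(X, Y)`. -/
noncomputable def homGE (n₀ : ℤ) : Submodule R (act.HomStar X Y) where
  carrier := {x | ∀ i < n₀, x.coeff act i = 0}
  zero_mem' _ _ := rfl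
  add_mem' {x y} hx hy i hi := by
    change x.coeff act i + y.coeff act i = 0
    rw [hx i hi, hy i hi, add_zero]
  smul_mem' r x hx := by
    induction r using DirectSum.Decomposition.inductionOn 𝒜 with
    | zero => intro i _; rw [zero_smul]; rfl
    | @homogeneous n r =>
      intro i hi
      rw [HomStar.coeff_smul act n r x (show (n : ℤ) + (i - n) = i by ring),
        hx _ (by omega), ShiftedHom.zero_comp]
    | add r s hr hs =>
      intro i hi
      rw [add_smul]
      change (r • x).coeff act i + (s • x).coeff act i = 0
      rw [hr i hi, hs i hi, add_zero]

/-- The `R₀`-module `Hom(X, ΣⁿY)`, as the degree `n` part of `Hom*(X, Y)`. -/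
noncomputable def homDegree (n : ℤ) :
    Submodule (SetLike.GradeZero.subring 𝒜) (act.HomStar X Y) where
  carrier := {x | ∀ i ≠ n, x.coeff act i = 0}
  zero_mem' _ _ := rfl
  add_mem' {x y} hx hy i hi := by
    change x.coeff act i + y.coeff act i = 0
    rw [hx i hi, hy i hi, add_zero]
  smul_mem' r x hx i hi := by
    change (r.1 • x).coeff act i = 0
    rw [HomStar.coeff_smul act 0 ⟨r.1, r.2⟩ x (show ((0 : ℕ) : ℤ) + i = i by simp), hx i hi,
      ShiftedHom.zero_comp]

/-- `Hom*(X, Y)` is eventually Noetherian of finite length over `R`: `Hom^{≥ n₀}(X, Y)` is a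
Noetherian `R`-module for some `n₀`, and `Hom(X, ΣⁿY)` has finite length over `R₀` for all
large `n`. -/
def IsEventuallyNoetherianOfFiniteLength : Prop :=
  (∃ n₀ : ℤ, IsNoetherian R (act.homGE X Y n₀)) ∧
    ∃ n₀ : ℤ, ∀ n ≥ n₀, IsFiniteLength (SetLike.GradeZero.subring 𝒜) (act.homDegree X Y n)

end CentralAction

end CentralAction

/-! ### The bounded derived category of finitely generated modules -/

section Db

variable (Λ : Type u) [Ring Λ] [HasDerivedCategory.{w} (ModuleCat.{u} Λ)]

/-- The objects of `D(Mod Λ)` with bounded and finitely generated cohomology. -/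
def isBoundedFG : ObjectProperty (DerivedCategory (ModuleCat.{u} Λ)) := fun X =>
  (∃ a b : ℤ, ∀ i : ℤ, i < a ∨ b < i →
    Limits.IsZero ((DerivedCategory.homologyFunctor (ModuleCat.{u} Λ) i).obj X)) ∧
  ∀ i : ℤ, Module.Finite Λ ((DerivedCategory.homologyFunctor (ModuleCat.{u} Λ) i).obj X)

/-- `Hⁱ(ΣⁿX)` is `Hⁿ⁺ⁱ(X)`. -/
noncomputable def homologyShiftIso (X : DerivedCategory (ModuleCat.{u} Λ)) (n i : ℤ) :
    (DerivedCategory.homologyFunctor (ModuleCat.{u} Λ) i).obj (X⟦n⟧) ≅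
      (DerivedCategory.homologyFunctor (ModuleCat.{u} Λ) (n + i)).obj X :=
  ((DerivedCategory.homologyFunctor (ModuleCat.{u} Λ) 0).shiftIso n i (n + i) rfl).app X

instance : (isBoundedFG Λ).IsStableUnderShift ℤ where
  isStableUnderShiftBy n := ⟨fun X hX => by
    obtain ⟨⟨a, b, hab⟩, hfg⟩ := hX
    refine ⟨⟨a - n, b - n, fun i hi => ?_⟩, fun i => ?_⟩
    · exact (hab (n + i) (by omega)).of_iso (homologyShiftIso Λ X n i)
    · have := hfg (n + i)
      exact Module.Finite.equiv (homologyShiftIso Λ X n i).toLinearEquiv.symm⟩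

/-- The bounded derived category `Dᵇ(Λ)` of finitely generated left `Λ`-modules (for a Noetherian
ring `Λ`), as the full subcategory of `D(Mod Λ)` of objects with bounded and finitely generated
cohomology. -/
abbrev BoundedDerivedCategory := (isBoundedFG Λ).FullSubcategory

variable {Λ} in
/-- A finitely generated module, seen as a complex concentrated in degree zero. -/
noncomputable def BoundedDerivedCategory.ofModule (M : ModuleCat.{u} Λ) [Module.Finite Λ M] :
    BoundedDerivedCategory Λ :=
  ⟨(DerivedCategory.singleFunctor (ModuleCat.{u} Λ) 0).obj M, by
    have h0 : ∀ i : ℤ, i ≠ 0 → Limits.IsZero ((DerivedCategory.homologyFunctor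
        (ModuleCat.{u} Λ) i).obj ((DerivedCategory.singleFunctor (ModuleCat.{u} Λ) 0).obj M)) := by
      intro i hi
      rcases lt_or_gt_of_ne hi with h | h
      · exact DerivedCategory.isZero_of_isGE _ 0 i h
      · exact DerivedCategory.isZero_of_isLE _ 0 i h
    refine ⟨⟨0, 0, fun i hi => h0 i (by omega)⟩, fun i => ?_⟩
    by_cases hi : i = 0
    · subst hi
      have : Module.Finite Λ ((𝟭 (ModuleCat.{u} Λ)).obj M) := ‹Module.Finite Λ M›
      exact Module.Finite.equiv
        ((DerivedCategory.singleFunctorCompHomologyFunctorIso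
          (ModuleCat.{u} Λ) 0).app M).toLinearEquiv.symm
    · have := ModuleCat.subsingleton_of_isZero (h0 i hi)
      infer_instance⟩

end Db

/-! ### The stable category of finitely generated modules -/

section Stable

variable (Λ : Type u) [Ring Λ]

/-- The morphism `f` of finitely generated modules factors through a (finitely generated)
projective module. -/
def FactorsThroughProjective {Λ : Type u} [Ring Λ] {X Y : FGModuleCat.{u} Λ} (f : X ⟶ Y) : Prop :=
  ∃ (P : FGModuleCat.{u} Λ) (a : X ⟶ P) (b : P ⟶ Y), Module.Projective Λ P ∧ a ≫ b = f

section

variable {Λ} {X Y Z : FGModuleCat.{u} Λ}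

lemma FactorsThroughProjective.zero : FactorsThroughProjective (0 : X ⟶ Y) :=
  ⟨FGModuleCat.of Λ PUnit.{u + 1}, 0, 0, inferInstanceAs (Module.Projective Λ PUnit.{u + 1}),
    by simp⟩

lemma FactorsThroughProjective.add {f g : X ⟶ Y} (hf : FactorsThroughProjective f)
    (hg : FactorsThroughProjective g) : FactorsThroughProjective (f + g) := by
  obtain ⟨P, a, b, hP, rfl⟩ := hf
  obtain ⟨Q, c, d, hQ, rfl⟩ := hg
  refine ⟨FGModuleCat.of Λ (P × Q), FGModuleCat.ofHom (a.hom.hom.prod c.hom.hom),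
    FGModuleCat.ofHom (b.hom.hom.coprod d.hom.hom), inferInstanceAs (Module.Projective Λ (P × Q)),
    ?_⟩
  ext x
  rfl

lemma FactorsThroughProjective.comp_left {f : X ⟶ Y} (hf : FactorsThroughProjective f)
    (g : Z ⟶ X) : FactorsThroughProjective (g ≫ f) := by
  obtain ⟨P, a, b, hP, rfl⟩ := hf
  exact ⟨P, g ≫ a, b, hP, by simp⟩

lemma FactorsThroughProjective.comp_right {f : X ⟶ Y} (hf : FactorsThroughProjective f)
    (g : Y ⟶ Z) : FactorsThroughProjective (f ≫ g) := by
  obtain ⟨P, a, b, hP, rfl⟩ := hf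
  exact ⟨P, a, b ≫ g, hP, by simp⟩

lemma FactorsThroughProjective.neg {f : X ⟶ Y} (hf : FactorsThroughProjective f) :
    FactorsThroughProjective (-f) := by
  obtain ⟨P, a, b, hP, rfl⟩ := hf
  exact ⟨P, a, -b, hP, by simp⟩

end

/-- Two morphisms are identified in the stable category if their difference factors through a
projective module. -/
def stableRel : HomRel (FGModuleCat.{u} Λ) := fun _ _ f g => FactorsThroughProjective (f - g)

instance : Congruence (stableRel Λ) where
  equivalence :=
    { refl := fun f => by
        change FactorsThroughProjective (f - f)
        rw [sub_self]
        exact .zero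
      symm := fun {f g} h => by
        change FactorsThroughProjective (g - f)
        rw [← neg_sub]
        exact h.neg
      trans := fun {f g h} h1 h2 => by
        change FactorsThroughProjective (f - h)
        rw [← sub_add_sub_cancel f g h]
        exact h1.add h2 }
  comp_left f _ _ h := by
    change FactorsThroughProjective (f ≫ _ - f ≫ _)
    rw [← Preadditive.comp_sub]
    exact h.comp_left f
  comp_right g h := by
    change FactorsThroughProjective (_ ≫ g - _ ≫ g)
    rw [← Preadditive.sub_comp]
    exact h.comp_right g

/-- The stable category of finitely generated `Λ`-modules: the morphisms are those of `mod Λ`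
modulo the morphisms that factor through projective modules. -/
abbrev StableMod := CategoryTheory.Quotient (stableRel Λ)

lemma stableRel_add ⦃X Y : FGModuleCat.{u} Λ⦄ (f₁ f₂ g₁ g₂ : X ⟶ Y) (hf : stableRel Λ f₁ f₂)
    (hg : stableRel Λ g₁ g₂) : stableRel Λ (f₁ + g₁) (f₂ + g₂) := by
  change FactorsThroughProjective _
  rw [add_sub_add_comm]
  exact hf.add hg

noncomputable instance : Preadditive (StableMod Λ) :=
  CategoryTheory.Quotient.preadditive _ (stableRel_add Λ)

instance : (CategoryTheory.Quotient.functor (stableRel Λ)).Additive :=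
  CategoryTheory.Quotient.functor_additive _ (stableRel_add Λ)

section Linear

variable (k : Type*) [CommRing k] [Algebra k Λ]

/-- The action of the scalars `k` on the modules over the `k`-algebra `Λ`, as a ring homomorphism
to the center of the category `mod Λ`. -/
noncomputable def scalarToCenter : k →+* CatCenter (FGModuleCat.{u} Λ) where
  toFun c :=
    { app := fun X => ObjectProperty.homMk (ModuleCat.ofHom
        { toFun := fun x : X.obj => algebraMap k Λ c • x
          map_add' := fun x y => smul_add _ x y
          map_smul' := fun a x => by
            rw [RingHom.id_apply, smul_smul, smul_smul, Algebra.commutes] })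
      naturality := fun X Y f => by
        ext x
        exact (map_smul f.hom.hom (algebraMap k Λ c) x).symm }
  map_one' := by
    ext X x
    exact (congrArg (· • x) (_root_.map_one (algebraMap k Λ))).trans (one_smul Λ x)
  map_mul' c d := by
    ext X x
    exact (congrArg (· • x) (_root_.map_mul (algebraMap k Λ) c d)).trans (mul_smul _ _ x)
  map_zero' := by
    ext X x
    exact (congrArg (· • x) (_root_.map_zero (algebraMap k Λ))).trans (zero_smul Λ x)
  map_add' c d := by
    ext X x
    exact (congrArg (· • x) (_root_.map_add (algebraMap k Λ) c d)).trans (add_smul _ _ x)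

/-- The stable category over a `k`-algebra is `k`-linear: `c • f` is the class of
`x ↦ c • f x`. -/
noncomputable instance : Linear k (StableMod Λ) :=
  letI : Linear k (FGModuleCat.{u} Λ) := Linear.ofRingMorphism (scalarToCenter Λ k)
  CategoryTheory.Quotient.linear k (stableRel Λ) (fun c X Y f g h => by
    change FactorsThroughProjective (c • f - c • g)
    rw [← smul_sub]
    exact h.comp_left _)

end Linear

/-! ### Suspension and syzygies -/

section Suspension

/-- A left `add Λ`-approximation of `X`: a map to a finitely generated projective module through
which every map from `X` to a finitely generated projective module factors. -/
structure LeftApprox {Λ : Type u} [Ring Λ] (X : FGModuleCat.{u} Λ) where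
  P : FGModuleCat.{u} Λ
  proj : Module.Projective Λ P
  i : X ⟶ P
  fac (Q : FGModuleCat.{u} Λ) (hQ : Module.Projective Λ Q) (f : X ⟶ Q) : ∃ g : P ⟶ Q, i ≫ g = f

/-- A presentation of `X` as a quotient of a finitely generated projective module. -/
structure ProjPres {Λ : Type u} [Ring Λ] (X : FGModuleCat.{u} Λ) where
  P : FGModuleCat.{u} Λ
  proj : Module.Projective Λ P
  p : P ⟶ X
  surj : Function.Surjective p.hom.hom

lemma isNoetherianRing_of_finite (k : Type*) [CommRing k] [IsArtinianRing k] [Algebra k Λ] [Module.Finite k Λ] :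
    IsNoetherianRing Λ :=
  isNoetherian_of_tower k (inferInstance : IsNoetherian k Λ)

variable {Λ}

lemma exists_dual_generators (k : Type*) [CommRing k] [IsArtinianRing k] [Algebra k Λ] [Module.Finite k Λ]
    (X : FGModuleCat.{u} Λ) :
    ∃ (n : ℕ) (f : Fin n → (X →ₗ[Λ] Λ)), Submodule.span k (Set.range f) = ⊤ := by
  obtain ⟨m, x, hx⟩ := Module.Finite.exists_fin (R := Λ) (M := X)
  let ev : (X →ₗ[Λ] Λ) →ₗ[k] (Fin m → Λ) :=
    { toFun := fun f j => f (x j)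
      map_add' := fun _ _ => rfl
      map_smul' := fun _ _ => rfl }
  have hev : Function.Injective ev := fun f g h => by
    refine LinearMap.ext_on hx ?_
    rintro _ ⟨j, rfl⟩
    exact congrFun h j
  have : Module.Finite k (X →ₗ[Λ] Λ) := Module.Finite.of_injective ev hev
  exact Module.Finite.exists_fin

lemma nonempty_leftApprox (k : Type*) [CommRing k] [IsArtinianRing k] [Algebra k Λ] [Module.Finite k Λ]
    (X : FGModuleCat.{u} Λ) : Nonempty (LeftApprox X) := by
  obtain ⟨n, f, hf⟩ := exists_dual_generators k X
  refine ⟨⟨FGModuleCat.of Λ (Fin n → Λ), inferInstanceAs (Module.Projective Λ (Fin n → Λ)),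
    ObjectProperty.homMk (ModuleCat.ofHom (LinearMap.pi f)), fun Q hQ h => ?_⟩⟩
  obtain ⟨m, p, hp⟩ := Module.Finite.exists_fin' Λ Q
  obtain ⟨s, hs⟩ := Module.projective_lifting_property p LinearMap.id hp
  have hc : ∀ j : Fin m, ∃ c : Fin n → k,
      ∑ i, c i • f i = (LinearMap.proj j).comp (s.comp h.hom.hom) := fun j =>
    (Submodule.mem_span_range_iff_exists_fun k).1 (hf ▸ Submodule.mem_top)
  choose c hc using hc
  refine ⟨ObjectProperty.homMk (ModuleCat.ofHom (p.comp
    (LinearMap.pi fun j => ∑ i, c j i • LinearMap.proj i))), ?_⟩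
  ext x
  change p _ = h.hom.hom x
  have h1 : p (s (h.hom.hom x)) = h.hom.hom x := LinearMap.congr_fun hs _
  rw [← h1]
  congr 1
  ext j
  have h2 := LinearMap.congr_fun (hc j) x
  simp only [LinearMap.sum_apply, LinearMap.smul_apply, LinearMap.comp_apply,
    LinearMap.proj_apply, LinearMap.pi_apply] at h2 ⊢
  exact h2

lemma nonempty_projPres (X : FGModuleCat.{u} Λ) : Nonempty (ProjPres X) := by
  obtain ⟨m, p, hp⟩ := Module.Finite.exists_fin' Λ X
  exact ⟨⟨FGModuleCat.of Λ (Fin m → Λ), inferInstanceAs (Module.Projective Λ (Fin m → Λ)),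
    ObjectProperty.homMk (ModuleCat.ofHom p), hp⟩⟩

/-- The cokernel of a left approximation. -/
def LeftApprox.coker {X : FGModuleCat.{u} Λ} (A : LeftApprox X) : FGModuleCat.{u} Λ :=
  FGModuleCat.of Λ (A.P ⧸ LinearMap.range A.i.hom.hom)

/-- The projection to the cokernel of a left approximation. -/
def LeftApprox.π {X : FGModuleCat.{u} Λ} (A : LeftApprox X) : A.P ⟶ A.coker :=
  ObjectProperty.homMk (ModuleCat.ofHom (Submodule.mkQ _))

lemma LeftApprox.i_π {X : FGModuleCat.{u} Λ} (A : LeftApprox X) : A.i ≫ A.π = 0 := by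
  ext x
  exact (Submodule.Quotient.mk_eq_zero _).2 ⟨x, rfl⟩

lemma LeftApprox.exists_desc {X Z : FGModuleCat.{u} Λ} (A : LeftApprox X) (g : A.P ⟶ Z)
    (hg : A.i ≫ g = 0) : ∃ h : A.coker ⟶ Z, A.π ≫ h = g := by
  refine ⟨ObjectProperty.homMk (ModuleCat.ofHom (Submodule.liftQ _ g.hom.hom ?_)), ?_⟩
  · rintro _ ⟨x, rfl⟩
    exact congrArg (fun f : X ⟶ Z => f.hom.hom x) hg
  · ext x
    rfl

lemma LeftApprox.π_cancel {X Z : FGModuleCat.{u} Λ} (A : LeftApprox X) {g h : A.coker ⟶ Z}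
    (e : A.π ≫ g = A.π ≫ h) : g = h := by
  ext x
  obtain ⟨y, rfl⟩ := Submodule.mkQ_surjective _ x
  exact congrArg (fun f : A.P ⟶ Z => f.hom.hom y) e

/-- The map `h` between cokernels is induced by `f`. -/
def LeftApprox.Induced {X Y : FGModuleCat.{u} Λ} (A : LeftApprox X) (B : LeftApprox Y) (f : X ⟶ Y)
    (h : A.coker ⟶ B.coker) : Prop :=
  ∃ g : A.P ⟶ B.P, A.i ≫ g = f ≫ B.i ∧ A.π ≫ h = g ≫ B.π

lemma LeftApprox.exists_induced {X Y : FGModuleCat.{u} Λ} (A : LeftApprox X) (B : LeftApprox Y)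
    (f : X ⟶ Y) : ∃ h, A.Induced B f h := by
  obtain ⟨g, hg⟩ := A.fac B.P B.proj (f ≫ B.i)
  obtain ⟨h, hh⟩ := A.exists_desc (g ≫ B.π) (by
    rw [← Category.assoc, hg, Category.assoc, B.i_π, Limits.comp_zero])
  exact ⟨h, g, hg, hh⟩

lemma LeftApprox.Induced.sub {X Y : FGModuleCat.{u} Λ} {A : LeftApprox X} {B : LeftApprox Y}
    {f f' : X ⟶ Y} {h h' : A.coker ⟶ B.coker} (H : A.Induced B f h) (H' : A.Induced B f' h') :
    A.Induced B (f - f') (h - h') := by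
  obtain ⟨g, h1, h2⟩ := H
  obtain ⟨g', h1', h2'⟩ := H'
  refine ⟨g - g', ?_, ?_⟩
  · rw [Preadditive.comp_sub, Preadditive.sub_comp, h1, h1']
  · rw [Preadditive.comp_sub, Preadditive.sub_comp, h2, h2']

lemma LeftApprox.Induced.comp {X Y Z : FGModuleCat.{u} Λ} {A : LeftApprox X} {B : LeftApprox Y}
    {C : LeftApprox Z} {f : X ⟶ Y} {f' : Y ⟶ Z} {h : A.coker ⟶ B.coker} {h' : B.coker ⟶ C.coker}
    (H : A.Induced B f h) (H' : B.Induced C f' h') : A.Induced C (f ≫ f') (h ≫ h') := by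
  obtain ⟨g, h1, h2⟩ := H
  obtain ⟨g', h1', h2'⟩ := H'
  refine ⟨g ≫ g', ?_, ?_⟩
  · rw [← Category.assoc, h1, Category.assoc, h1', Category.assoc]
  · rw [← Category.assoc, h2, Category.assoc, h2', Category.assoc]

lemma LeftApprox.Induced.factors {X Y : FGModuleCat.{u} Λ} {A : LeftApprox X} {B : LeftApprox Y}
    {f : X ⟶ Y} {h : A.coker ⟶ B.coker} (H : A.Induced B f h) (hf : FactorsThroughProjective f) :
    FactorsThroughProjective h := by
  obtain ⟨g, h1, h2⟩ := H
  obtain ⟨Q, a, b, hQ, rfl⟩ := hf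
  obtain ⟨a', rfl⟩ := A.fac Q hQ a
  obtain ⟨v, hv⟩ := A.exists_desc (g - a' ≫ b ≫ B.i) (by
    rw [Preadditive.comp_sub, h1]
    simp)
  refine ⟨B.P, v, B.π, B.proj, A.π_cancel ?_⟩
  rw [← Category.assoc, hv, Preadditive.sub_comp, h2, Category.assoc, Category.assoc, B.i_π]
  simp

lemma LeftApprox.Induced.sound {X Y : FGModuleCat.{u} Λ} {A : LeftApprox X} {B : LeftApprox Y}
    {f f' : X ⟶ Y} {h h' : A.coker ⟶ B.coker} (H : A.Induced B f h) (H' : A.Induced B f' h')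
    (hf : stableRel Λ f f') : (CategoryTheory.Quotient.functor (stableRel Λ)).map h =
      (CategoryTheory.Quotient.functor (stableRel Λ)).map h' :=
  CategoryTheory.Quotient.sound _ ((H.sub H').factors hf)

/-- A chosen left `add Λ`-approximation. -/
noncomputable def leftApprox (k : Type*) [CommRing k] [IsArtinianRing k] [Algebra k Λ] [Module.Finite k Λ]
    (X : FGModuleCat.{u} Λ) : LeftApprox X :=
  (nonempty_leftApprox k X).some

variable (Λ) in
/-- The functor `Σ` on the stable category: it sends `X` to the cokernel of a left
`add Λ`-approximation `X ⟶ P` and the class of a map to the class of any induced map between the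
cokernels. -/
noncomputable def stableSuspension (k : Type*) [CommRing k] [IsArtinianRing k] [Algebra k Λ] [Module.Finite k Λ] :
    StableMod Λ ⥤ StableMod Λ :=
  CategoryTheory.Quotient.lift (stableRel Λ)
    { obj := fun X => (CategoryTheory.Quotient.functor (stableRel Λ)).obj (leftApprox k X).coker
      map := fun {X Y} f => (CategoryTheory.Quotient.functor (stableRel Λ)).map
        ((leftApprox k X).exists_induced (leftApprox k Y) f).choose
      map_id := fun X => by
        rw [← (CategoryTheory.Quotient.functor (stableRel Λ)).map_id]
        exact ((leftApprox k X).exists_induced (leftApprox k X) (𝟙 X)).choose_spec.sound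
          ⟨𝟙 _, by simp, by simp⟩ (Congruence.equivalence.refl _)
      map_comp := fun {X Y Z} f g => by
        rw [← (CategoryTheory.Quotient.functor (stableRel Λ)).map_comp]
        exact ((leftApprox k X).exists_induced (leftApprox k Z) (f ≫ g)).choose_spec.sound
          (((leftApprox k X).exists_induced (leftApprox k Y) f).choose_spec.comp
            ((leftApprox k Y).exists_induced (leftApprox k Z) g).choose_spec)
          (Congruence.equivalence.refl _) }
    (fun X Y f f' h => ((leftApprox k X).exists_induced (leftApprox k Y) f).choose_spec.sound
      ((leftApprox k X).exists_induced (leftApprox k Y) f').choose_spec h)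

lemma ProjPres.fac {X : FGModuleCat.{u} Λ} (A : ProjPres X) (Q : FGModuleCat.{u} Λ)
    (hQ : Module.Projective Λ Q) (f : Q ⟶ X) : ∃ g : Q ⟶ A.P, g ≫ A.p = f := by
  obtain ⟨g, hg⟩ := Module.projective_lifting_property A.p.hom.hom f.hom.hom A.surj
  refine ⟨ObjectProperty.homMk (ModuleCat.ofHom g), ?_⟩
  ext x
  exact LinearMap.congr_fun hg x

variable [IsNoetherianRing Λ]

/-- The syzygy: the kernel of a projective presentation. -/
def ProjPres.ker {X : FGModuleCat.{u} Λ} (A : ProjPres X) : FGModuleCat.{u} Λ :=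
  ⟨ModuleCat.of Λ (LinearMap.ker A.p.hom.hom), by
    have : IsNoetherian Λ A.P := isNoetherian_of_isNoetherianRing_of_finite Λ A.P
    exact (inferInstance : Module.Finite Λ (LinearMap.ker A.p.hom.hom))⟩

/-- The inclusion of the syzygy. -/
def ProjPres.ι {X : FGModuleCat.{u} Λ} (A : ProjPres X) : A.ker ⟶ A.P :=
  ObjectProperty.homMk (ModuleCat.ofHom (Submodule.subtype _))

lemma ProjPres.ι_p {X : FGModuleCat.{u} Λ} (A : ProjPres X) : A.ι ≫ A.p = 0 := by
  ext x
  exact x.2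

lemma ProjPres.exists_lift {X Z : FGModuleCat.{u} Λ} (A : ProjPres X) (g : Z ⟶ A.P)
    (hg : g ≫ A.p = 0) : ∃ h : Z ⟶ A.ker, h ≫ A.ι = g :=
  ⟨ObjectProperty.homMk (ModuleCat.ofHom (LinearMap.codRestrict _ g.hom.hom
    (fun x => congrArg (fun f : Z ⟶ X => f.hom.hom x) hg))), rfl⟩

lemma ProjPres.ι_cancel {X Z : FGModuleCat.{u} Λ} (A : ProjPres X) {g h : Z ⟶ A.ker}
    (e : g ≫ A.ι = h ≫ A.ι) : g = h := by
  ext x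
  exact Subtype.ext (congrArg (fun f : Z ⟶ A.P => f.hom.hom x) e)

/-- The map `h` between syzygies is induced by `f`. -/
def ProjPres.Induced {X Y : FGModuleCat.{u} Λ} (A : ProjPres X) (B : ProjPres Y) (f : X ⟶ Y)
    (h : A.ker ⟶ B.ker) : Prop :=
  ∃ g : A.P ⟶ B.P, g ≫ B.p = A.p ≫ f ∧ h ≫ B.ι = A.ι ≫ g

lemma ProjPres.exists_induced {X Y : FGModuleCat.{u} Λ} (A : ProjPres X) (B : ProjPres Y)
    (f : X ⟶ Y) : ∃ h, A.Induced B f h := by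
  obtain ⟨g, hg⟩ := B.fac A.P A.proj (A.p ≫ f)
  obtain ⟨h, hh⟩ := B.exists_lift (A.ι ≫ g) (by
    rw [Category.assoc, hg, ← Category.assoc, A.ι_p, Limits.zero_comp])
  exact ⟨h, g, hg, hh⟩

lemma ProjPres.Induced.sub {X Y : FGModuleCat.{u} Λ} {A : ProjPres X} {B : ProjPres Y}
    {f f' : X ⟶ Y} {h h' : A.ker ⟶ B.ker} (H : A.Induced B f h) (H' : A.Induced B f' h') :
    A.Induced B (f - f') (h - h') := by
  obtain ⟨g, h1, h2⟩ := H
  obtain ⟨g', h1', h2'⟩ := H'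
  refine ⟨g - g', ?_, ?_⟩
  · rw [Preadditive.comp_sub, Preadditive.sub_comp, h1, h1']
  · rw [Preadditive.comp_sub, Preadditive.sub_comp, h2, h2']

lemma ProjPres.Induced.comp {X Y Z : FGModuleCat.{u} Λ} {A : ProjPres X} {B : ProjPres Y}
    {C : ProjPres Z} {f : X ⟶ Y} {f' : Y ⟶ Z} {h : A.ker ⟶ B.ker} {h' : B.ker ⟶ C.ker}
    (H : A.Induced B f h) (H' : B.Induced C f' h') : A.Induced C (f ≫ f') (h ≫ h') := by
  obtain ⟨g, h1, h2⟩ := H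
  obtain ⟨g', h1', h2'⟩ := H'
  refine ⟨g ≫ g', ?_, ?_⟩
  · rw [Category.assoc, h1', ← Category.assoc, h1, Category.assoc]
  · rw [Category.assoc, h2', ← Category.assoc, h2, Category.assoc]

lemma ProjPres.Induced.factors {X Y : FGModuleCat.{u} Λ} {A : ProjPres X} {B : ProjPres Y}
    {f : X ⟶ Y} {h : A.ker ⟶ B.ker} (H : A.Induced B f h)
    (hf : FactorsThroughProjective f) : FactorsThroughProjective h := by
  obtain ⟨g, h1, h2⟩ := H
  obtain ⟨Q, a, b, hQ, rfl⟩ := hf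
  obtain ⟨b', rfl⟩ := B.fac Q hQ b
  obtain ⟨v, hv⟩ := B.exists_lift (g - A.p ≫ a ≫ b') (by
    rw [Preadditive.sub_comp, h1]
    simp)
  refine ⟨A.P, A.ι, v, A.proj, B.ι_cancel ?_⟩
  rw [Category.assoc, hv, Preadditive.comp_sub, h2, ← Category.assoc (A.ι) A.p, A.ι_p]
  simp

lemma ProjPres.Induced.sound {X Y : FGModuleCat.{u} Λ} {A : ProjPres X} {B : ProjPres Y}
    {f f' : X ⟶ Y} {h h' : A.ker ⟶ B.ker} (H : A.Induced B f h) (H' : A.Induced B f' h')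
    (hf : stableRel Λ f f') : (CategoryTheory.Quotient.functor (stableRel Λ)).map h =
      (CategoryTheory.Quotient.functor (stableRel Λ)).map h' :=
  CategoryTheory.Quotient.sound _ ((H.sub H').factors hf)

/-- A chosen projective presentation. -/
noncomputable def projPres (X : FGModuleCat.{u} Λ) : ProjPres X :=
  (nonempty_projPres X).some

variable (Λ) in
/-- The syzygy functor `Ω` on the stable category: it sends `X` to the kernel of a surjection
`P ⟶ X` with `P` projective, and the class of a map to the class of any induced map between the
kernels. -/
noncomputable def stableSyzygy : StableMod Λ ⥤ StableMod Λ :=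
  CategoryTheory.Quotient.lift (stableRel Λ)
    { obj := fun X => (CategoryTheory.Quotient.functor (stableRel Λ)).obj ((projPres X).ker)
      map := fun {X Y} f => (CategoryTheory.Quotient.functor (stableRel Λ)).map
        ((projPres X).exists_induced (projPres Y) f).choose
      map_id := fun X => by
        rw [← (CategoryTheory.Quotient.functor (stableRel Λ)).map_id]
        exact ((projPres X).exists_induced (projPres X) (𝟙 X)).choose_spec.sound
          ⟨𝟙 _, by simp, by simp⟩ (Congruence.equivalence.refl _)
      map_comp := fun {X Y Z} f g => by
        rw [← (CategoryTheory.Quotient.functor (stableRel Λ)).map_comp]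
        exact ((projPres X).exists_induced (projPres Z) (f ≫ g)).choose_spec.sound
          (((projPres X).exists_induced (projPres Y) f).choose_spec.comp
            ((projPres Y).exists_induced (projPres Z) g).choose_spec)
          (Congruence.equivalence.refl _) }
    (fun X Y f f' h => ((projPres X).exists_induced (projPres Y) f).choose_spec.sound
      ((projPres X).exists_induced (projPres Y) f').choose_spec h)

end Suspension

/-- The `n`-fold composite of an endofunctor. -/
def functorPow {C : Type*} [Category C] (F : C ⥤ C) : ℕ → (C ⥤ C)
  | 0 => 𝟭 C
  | n + 1 => functorPow F n ⋙ F

/-- `Σᵈ` for `d ∈ ℤ`; the negative powers are the powers of `Ω`, which is inverse to `Σ` on maximal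
Cohen-Macaulay modules over a Gorenstein algebra. -/
noncomputable def stableShift (k : Type*) [CommRing k] [IsArtinianRing k] [Algebra k Λ] [Module.Finite k Λ] :
    ℤ → (StableMod Λ ⥤ StableMod Λ)
  | Int.ofNat n => functorPow (stableSuspension Λ k) n
  | Int.negSucc n =>
    haveI := isNoetherianRing_of_finite Λ k
    functorPow (stableSyzygy Λ) (n + 1)

/-! ### Maximal Cohen-Macaulay modules and stably symmetric algebras -/

/-- Maximal Cohen-Macaulay modules, as objects of the stable category of finitely generated
modules: `Extⁱ(M, Λ) = 0` for all `i > 0`. -/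
def isMCM : ObjectProperty (StableMod Λ) := fun M =>
  ∀ i : ℕ, 0 < i → Subsingleton (Ext.{u} M.as.obj (ModuleCat.of Λ Λ) i)

/-- The stable category of maximal Cohen-Macaulay `Λ`-modules. -/
abbrev StableMCM := (isMCM Λ).FullSubcategory

/-- A Serre functor on a `k`-linear category `T`, for the duality `D = Hom_k(-, E)`: a `k`-linear
equivalence `S` with `k`-linear isomorphisms `Hom(X, Y) ≃ D Hom(Y, S X)` that are functorial in
`X` and `Y`. -/
structure SerreFunctor (k : Type*) [CommRing k] (E : Type*) [AddCommGroup E] [Module k E]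
    (T : Type*) [Category T] [Preadditive T] [Linear k T] where
  S : T ⥤ T
  additive : S.Additive
  linear : S.Linear k
  isEquivalence : S.IsEquivalence
  duality (X Y : T) : (X ⟶ Y) ≃ₗ[k] ((Y ⟶ S.obj X) →ₗ[k] E)
  natural_left {X' X Y : T} (a : X' ⟶ X) (f : X ⟶ Y) (h : Y ⟶ S.obj X') :
    duality X' Y (a ≫ f) h = duality X Y f (h ≫ S.map a)
  natural_right {X Y Y' : T} (f : X ⟶ Y) (b : Y ⟶ Y') (h : Y' ⟶ S.obj X) :
    duality X Y' (f ≫ b) h = duality X Y f (b ≫ h)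

/-- `Λ` is stably symmetric: the stable category of maximal Cohen-Macaulay modules is weakly
`d`-Calabi-Yau for some `d ∈ ℤ`, that is, it has a Serre functor isomorphic to `Σᵈ`. -/
def IsStablySymmetric (k : Type*) [CommRing k] [IsArtinianRing k] [Algebra k Λ]
    [Module.Finite k Λ] (E : Type*) [AddCommGroup E] [Module k E] : Prop :=
  ∃ (d : ℤ) (F : SerreFunctor k E (StableMCM Λ)),
    Nonempty (F.S ⋙ (isMCM Λ).ι ≅ (isMCM Λ).ι ⋙ stableShift Λ k d)

end Stable

/-!
Fix `Y` in a triangulated category with a central action of `R` for which `Hom*(X, Y)` is eventually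
Noetherian. The cone of a homogeneous central element `r` of even degree on `X` is an object on
which `r²` acts as zero. Taking cones on finitely many elements that generate the positive even part
of `R` up to its annihilator, one reaches an object `K` such that `Hom(K, ΣⁱY)` vanishes for large
`i`, and the long exact sequences of the cones reduce questions about `X` to questions about `K`.

In `Dᵇ(Λ)` this gives the gap theorem: if `Extⁱ(M, Λ)` vanishes for `i ≥ a` and `Extⁱ(M, N)`
vanishes for large `i`, then `Extⁱ(M, N)` vanishes for `i ≥ a`. Also `id Λ` is finite, because
central elements of positive degree act as zero on `Ext*(-, Λ)`; so high syzygies are maximal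
Cohen-Macaulay. For such modules `X` and `Y`, if `Extⁱ(X, Y)` vanishes for large `i`, then the gap
theorem, applied to the syzygies of `Y`, makes all stable `Hom(ΩX, ΩʲY)` vanish. By Serre duality
with `S ≅ Σᵈ`, so do the stable `Hom(ΩⁱY, ΩX)` for large `i`, and with them `Extⁱ(Y, X)`.
-/

/-! ### Noetherian modules -/

section NoetherianModules

open Module (annihilator)

/-- A Reynolds operator carries the Noetherian property down to the ring `A`. -/
lemma isNoetherian_range_of_isIdempotentElem {A R M : Type*} [Ring A] [Ring R] [AddCommGroup M]
    [Module A M] [Module R M] [IsNoetherian R M] {p : M →ₗ[A] M} (hp : IsIdempotentElem p)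
    (hsmul : ∀ r : R, ∃ a : A, ∀ x, p (r • p x) = a • p x) :
    IsNoetherian A (LinearMap.range p) := by
  have fixed : ∀ x ∈ LinearMap.range p, p x = x := by
    rintro _ ⟨x, rfl⟩
    exact LinearMap.congr_fun hp x
  refine isNoetherian_submodule.2 fun s hs => ?_
  obtain ⟨t, hts, hspan⟩ := (Submodule.fg_span_iff_fg_span_finset_subset (R := R) (s : Set M)).1
    (IsNoetherian.noetherian _)
  refine ⟨t, le_antisymm (Submodule.span_le.2 hts) fun x hx => ?_⟩
  obtain ⟨c, -, rfl⟩ := Submodule.mem_span_finset.1 (hspan ▸ Submodule.subset_span hx)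
  rw [← fixed _ (hs hx), map_sum]
  refine Submodule.sum_mem _ fun y hy => ?_
  obtain ⟨a, ha⟩ := hsmul (c y)
  have hay : p (c y • y) = a • y := by simpa only [fixed y (hs (hts hy))] using ha y
  exact hay ▸ Submodule.smul_mem _ a (Submodule.subset_span hy)

variable {A : Type*} [CommRing A]

lemma annihilator_mul_annihilator_le_of_exact {M N P : Type*} [AddCommGroup M] [AddCommGroup N]
    [AddCommGroup P] [Module A M] [Module A N] [Module A P] {f : M →ₗ[A] N} {g : N →ₗ[A] P}
    (h : Function.Exact f g) : annihilator A M * annihilator A P ≤ annihilator A N := by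
  refine Ideal.mul_le.2 fun a ha b hb => Module.mem_annihilator.2 fun y => ?_
  obtain ⟨x, hx⟩ := (h (b • y)).1 (by rw [map_smul, Module.mem_annihilator.1 hb])
  rw [mul_smul, ← hx, ← map_smul, Module.mem_annihilator.1 ha, map_zero]

variable (M : Type*) [AddCommGroup M] [Module A M] [IsNoetherian A M]

/-- `A` is Noetherian modulo the annihilator of `M`, as it embeds into a power of `M`. -/
lemma exists_finset_span_le_span_sup_annihilator (s : Set A) :
    ∃ t : Finset A, (t : Set A) ⊆ s ∧ Ideal.span s ≤ Ideal.span t ⊔ annihilator A M := by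
  classical
  obtain ⟨n, v, hv⟩ := Module.Finite.exists_fin (R := A) (M := M)
  let φ : A →ₗ[A] Fin n → M := LinearMap.pi fun i => LinearMap.toSpanSingleton A M (v i)
  have hφ : LinearMap.ker φ ≤ annihilator A M := fun a ha => by
    rw [← Submodule.annihilator_top, ← hv, Submodule.mem_annihilator_span]
    rintro ⟨_, i, rfl⟩
    exact congrFun (LinearMap.mem_ker.1 ha) i
  obtain ⟨t', ht', hspan⟩ := (Submodule.fg_span_iff_fg_span_finset_subset (R := A) (φ '' s)).1
    (IsNoetherian.noetherian _)
  obtain ⟨t, hts, rfl⟩ := Finset.subset_set_image_iff.1 ht'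
  refine ⟨t, hts, le_trans ((LinearMap.map_le_map_iff φ).1 ?_) (sup_le_sup_left hφ _)⟩
  rw [Ideal.span, Ideal.span, Submodule.map_span, Submodule.map_span, hspan, Finset.coe_image]

lemma exists_pow_le_annihilator_of_le_radical {I : Ideal A} (hI : I ≤ (annihilator A M).radical) :
    ∃ k : ℕ, I ^ k ≤ annihilator A M := by
  obtain ⟨t, htI, hspan⟩ := exists_finset_span_le_span_sup_annihilator M (I : Set A)
  obtain ⟨k, hk⟩ := Ideal.exists_pow_le_of_le_radical_of_fg
    ((Ideal.span_le.2 htI).trans hI) ⟨t, rfl⟩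
  rw [Ideal.span_eq] at hspan
  exact ⟨k + 1, (Ideal.pow_right_mono hspan _).trans
    (Ideal.sup_pow_add_le_pow_sup_pow.trans (sup_le hk (pow_one _).le))⟩

end NoetherianModules

/-! ### The even part of a graded-commutative ring -/

section EvenCenter

variable {R : Type*} [Ring R] {𝒜 : ℕ → AddSubgroup R} [GradedRing 𝒜]

lemma IsGradedCommutative.mem_center (hR : IsGradedCommutative 𝒜) {n : ℕ} (hn : Even n) {r : R}
    (hr : r ∈ 𝒜 n) : r ∈ Subring.center R := by
  refine Subring.mem_center_iff.2 fun s => ?_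
  induction s using DirectSum.Decomposition.inductionOn 𝒜 with
  | zero => rw [zero_mul, mul_zero]
  | @homogeneous m s => rw [hR hr s.2, (hn.mul_right m).neg_one_pow, one_mul]
  | add s t hs ht => rw [add_mul, mul_add, hs, ht]

variable (𝒜)

/-- The homogeneous central elements of even degree. -/
def evenHomogeneous : Submonoid (Subring.center R) where
  carrier := {z | ∃ n : ℕ, Even n ∧ (z : R) ∈ 𝒜 n}
  one_mem' := ⟨0, Even.zero, SetLike.GradedOne.one_mem⟩
  mul_mem' := fun ⟨m, hm, hy⟩ ⟨n, hn, hz⟩ => ⟨m + n, hm.add hn, SetLike.GradedMul.mul_mem hy hz⟩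

/-- The ring of sums of homogeneous central elements of even degree, which is the even part of `R`
if `R` is graded-commutative. It is a subring of the center of `R`, so that it is a commutative
ring. -/
def evenCenter : Subring (Subring.center R) :=
  Subring.closure (evenHomogeneous 𝒜)

/-- The ideal of the even part generated by the homogeneous elements of positive degree. -/
def evenIrrelevantIdeal : Ideal (evenCenter 𝒜) :=
  Ideal.span {z | ∃ n : ℕ, Even n ∧ 0 < n ∧ (z : R) ∈ 𝒜 n}

variable {𝒜}

lemma evenCenter_induction {motive : R → Prop}
    (homogeneous : ∀ {n : ℕ} (r : 𝒜 n), Even n → motive r)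
    (add : ∀ r s, motive r → motive s → motive (r + s)) (e : evenCenter 𝒜) : motive e := by
  obtain ⟨z, hz⟩ := e
  change motive z
  replace hz : z ∈ AddSubgroup.closure (evenHomogeneous 𝒜 : Set (Subring.center R)) := by
    simpa only [evenCenter, Subring.mem_closure_iff, Submonoid.closure_eq] using hz
  induction hz using AddSubgroup.closure_induction'' with
  | zero => exact homogeneous (0 : 𝒜 0) Even.zero
  | mem z hz =>
    obtain ⟨n, hn, hzn⟩ := hz
    exact homogeneous ⟨z, hzn⟩ hn
  | neg_mem z hz =>
    obtain ⟨n, hn, hzn⟩ := hz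
    exact homogeneous (-⟨z, hzn⟩) hn
  | add y z _ _ hy hz => exact add _ _ hy hz

/-- An even homogeneous element, as an element of the even part. -/
def IsGradedCommutative.toEvenCenter (hR : IsGradedCommutative 𝒜) {n : ℕ} (hn : Even n)
    (r : 𝒜 n) : evenCenter 𝒜 :=
  ⟨⟨r, hR.mem_center hn r.2⟩, Subring.subset_closure ⟨n, hn, r.2⟩⟩

end EvenCenter

/-! ### The graded center -/

section GradedCenter

variable {T : Type*} [Category T] [HasShift T ℤ]

/-- The identity of `ΣᵐX`, seen as a morphism of degree `m` to `X`, is a split monomorphism. -/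
lemma exists_shiftedHom_comp_eq_id (X : T) (m : ℤ) :
    ∃ (σ : ShiftedHom (X⟦m⟧) X m) (τ : ShiftedHom X (X⟦m⟧) (-m)),
      σ.comp τ (neg_add_cancel m) = ShiftedHom.mk₀ 0 rfl (𝟙 _) := by
  refine ⟨𝟙 _, (shiftShiftNeg X m).inv, ?_⟩
  simp only [ShiftedHom.comp, ShiftedHom.mk₀, Category.id_comp]
  change ((shiftFunctorCompIsoId T m (-m) (add_neg_cancel m)).inv.app X)⟦m⟧' ≫ _ = _
  rw [shift_shiftFunctorCompIsoId_inv_app]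
  simp [shiftFunctorCompIsoId, shiftFunctorZero']

/-- The commutation of `Σⁿ` with the shifts through the canonical isomorphisms, without the signs
that make `Σⁿ` a triangulated functor. -/
noncomputable abbrev shiftFunctorCommShift (n : ℤ) : (shiftFunctor T n).CommShift ℤ where
  commShiftIso m := shiftFunctorComm T m n
  commShiftIso_zero := by
    ext X
    rw [← shiftFunctorComm_symm, Iso.symm_hom, ← cancel_mono ((shiftFunctorComm T n 0).hom.app X),
      Iso.inv_hom_id_app, shiftFunctorComm_zero_hom_app]
    simp [← Functor.map_comp]
  commShiftIso_add a b := by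
    ext X
    have h := shiftFunctorComm_hom_app_comp_shift_shiftFunctorAdd_hom_app n a b X
    rw [← shiftFunctorComm_symm, Iso.symm_hom,
      ← cancel_mono ((shiftFunctorComm T n (a + b)).hom.app X), Iso.inv_hom_id_app,
      ← cancel_mono (((shiftFunctorAdd T a b).hom.app X)⟦n⟧'), Category.assoc, h]
    simp only [Functor.CommShift.isoAdd_hom_app, Category.assoc]
    rw [← shiftFunctorComm_symm T n a, ← shiftFunctorComm_symm T n b]
    simp [← Functor.map_comp_assoc]

variable [Preadditive T] [∀ n : ℤ, (shiftFunctor T n).Additive]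

lemma centerApp_shift {n : ℤ} (hn : Even n) (f : gradedCenter T n) (m : ℕ) (X : T) :
    centerApp f (X⟦(m : ℤ)⟧) =
      (centerApp f X)⟦(m : ℤ)⟧' ≫ (shiftFunctorComm T n m).hom.app X := by
  let _ := shiftFunctorCommShift (T := T) n
  have commShiftIso_eq (a : ℤ) :
      Functor.commShiftIso (shiftFunctor T n) a = (shiftFunctorComm T n a).symm :=
    (shiftFunctorComm_symm T n a).symm
  have core_one : NatTrans.CommShiftCore f.1 (1 : ℤ) := ⟨by
    ext X
    have hX : f.1.app (X⟦(1 : ℤ)⟧) = (f.1.app X)⟦(1 : ℤ)⟧' ≫ (shiftComm X n (1 : ℤ)).hom := by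
      simpa only [Int.negOnePow_even n hn, one_smul] using f.2 X
    simp only [NatTrans.comp_app, Functor.whiskerRight_app, Functor.whiskerLeft_app]
    rw [hX, commShiftIso_eq]
    simp⟩
  have core : NatTrans.CommShiftCore f.1 (m : ℤ) := by
    induction m with
    | zero => exact .zero _
    | succ m ih => exact Nat.cast_succ (R := ℤ) m ▸ ih.add core_one
  rw [centerApp, core.app_shift, commShiftIso_eq]
  simp

lemma comp_centerApp_eq_centerApp_comp_map {n : ℤ} (f : gradedCenter T n) {X Y : T} (g : X ⟶ Y) :
    g ≫ centerApp f Y = centerApp f X ≫ g⟦n⟧' :=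
  f.1.naturality g

lemma shiftedHom_comp_centerApp {n : ℤ} (hn : Even n) (f : gradedCenter T n) {X Y : T} {m : ℕ}
    (g : ShiftedHom X Y (m : ℤ)) {c : ℤ} (h : n + m = c) :
    g.comp (centerApp f Y) h = (centerApp f X).comp g (by rw [← h, add_comm]) := by
  have naturality := comp_centerApp_eq_centerApp_comp_map f g
  rw [centerApp_shift hn f m Y] at naturality
  simp only [ShiftedHom.comp]
  rw [← reassoc_of% naturality, shiftFunctorComm_eq T n m c h]
  simp

open Pretriangulated in
/-- On the cone of `f_X`, both `j ≫ f` and `p ≫ f_{ΣX}` vanish, so that `f` factors through `p`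
and `f²` vanishes. -/
lemma centerApp_comp_self_eq_zero_of_cone [Limits.HasZeroObject T] [Pretriangulated T] {n : ℕ}
    (hn : Even n) (f : gradedCenter T (n : ℤ)) {X K : T} {j : X⟦(n : ℤ)⟧ ⟶ K}
    {p : K ⟶ X⟦(1 : ℤ)⟧} (hD : Triangle.mk (centerApp f X) j p ∈ distTriang T) :
    (centerApp f K).comp (centerApp f K) (Nat.cast_add n n).symm = 0 := by
  have hn' : Even (n : ℤ) := (Int.even_coe_nat n).2 hn
  have j_comp : j ≫ centerApp f K = 0 := by
    have hj : centerApp f X ≫ j = 0 := comp_distTriang_mor_zero₁₂ _ hD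
    have shift_app : centerApp f (X⟦(n : ℤ)⟧) = (centerApp f X)⟦(n : ℤ)⟧' := by
      rw [centerApp_shift hn', shiftFunctorComm_eq_refl]
      exact Category.comp_id _
    rw [comp_centerApp_eq_centerApp_comp_map, shift_app, ← Functor.map_comp, hj, Functor.map_zero]
  have p_comp : p ≫ centerApp f (X⟦(1 : ℤ)⟧) = 0 := by
    have hp : p ≫ (centerApp f X)⟦(1 : ℤ)⟧' = 0 := comp_distTriang_mor_zero₃₁ _ hD
    have shift_app := centerApp_shift hn' f 1 X
    rw [Nat.cast_one] at shift_app
    rw [shift_app, reassoc_of% hp, Limits.zero_comp]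
  obtain ⟨g, hg⟩ : ∃ g : ShiftedHom (X⟦(1 : ℤ)⟧) K (n : ℤ), centerApp f K = p ≫ g :=
    Triangle.yoneda_exact₃ _ hD _ j_comp
  calc (centerApp f K).comp (centerApp f K) (Nat.cast_add n n).symm
      = p ≫ g.comp (centerApp f K) (Nat.cast_add n n).symm := by
        nth_rw 1 [hg]
        simp only [ShiftedHom.comp, Category.assoc]
    _ = p ≫ (centerApp f (X⟦(1 : ℤ)⟧)).comp g _ := by rw [shiftedHom_comp_centerApp hn' f g]
    _ = 0 := by rw [ShiftedHom.comp, reassoc_of% p_comp, Limits.zero_comp]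

end GradedCenter

/-! ### Graded Hom groups -/

namespace CentralAction

variable {R : Type*} [Ring R] {T : Type*} [Category T] [Preadditive T] [HasShift T ℤ]
  [∀ n : ℤ, (shiftFunctor T n).Additive] {𝒜 : ℕ → AddSubgroup R} [GradedRing 𝒜]
  {act : CentralAction T 𝒜} {X Y X' Y' : T}

namespace HomStar

variable (act) in
/-- A morphism `X ⟶ ΣⁱY`, as an element of `Hom*(X, Y)` that is homogeneous of degree `i`. -/
noncomputable def of (i : ℤ) (g : ShiftedHom X Y i) : act.HomStar X Y :=
  DirectSum.of (fun i : ℤ => ShiftedHom X Y i) i g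

@[simp] lemma coeff_zero (i : ℤ) : (0 : act.HomStar X Y).coeff act i = 0 := rfl

@[simp] lemma coeff_add (x y : act.HomStar X Y) (i : ℤ) :
    (x + y).coeff act i = x.coeff act i + y.coeff act i := rfl

@[ext] lemma ext_coeff {x y : act.HomStar X Y} (h : ∀ i, x.coeff act i = y.coeff act i) : x = y :=
  DFinsupp.ext h

@[simp] lemma coeff_of_same (i : ℤ) (g : ShiftedHom X Y i) : (of act i g).coeff act i = g :=
  DirectSum.of_eq_same _ _

lemma of_zero (i : ℤ) : of act i (0 : ShiftedHom X Y i) = 0 :=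
  map_zero (DirectSum.of (fun i : ℤ => ShiftedHom X Y i) i)

lemma of_add (i : ℤ) (g g' : ShiftedHom X Y i) : of act i (g + g') = of act i g + of act i g' :=
  map_add (DirectSum.of (fun i : ℤ => ShiftedHom X Y i) i) g g'

lemma coeff_of_ne {i j : ℤ} (g : ShiftedHom X Y i) (h : j ≠ i) : (of act i g).coeff act j = 0 :=
  DirectSum.of_eq_of_ne _ _ _ h

lemma induction_of {motive : act.HomStar X Y → Prop} (x : act.HomStar X Y) (zero : motive 0)
    (of : ∀ i g, motive (of act i g)) (add : ∀ x y, motive x → motive y → motive (x + y)) :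
    motive x :=
  DirectSum.induction_on (motive := motive) x zero of add

lemma mem_of_forall_of_coeff_mem {S : AddSubmonoid (act.HomStar X Y)} {x : act.HomStar X Y}
    (h : ∀ i, of act i (x.coeff act i) ∈ S) : x ∈ S := by
  classical
  rw [← DirectSum.sum_support_of (show ⨁ i : ℤ, ShiftedHom X Y i from x)]
  exact S.sum_mem fun i _ => h i

lemma exists_coeff_eq_zero_of_gt (x : act.HomStar X Y) : ∃ b : ℤ, ∀ i > b, x.coeff act i = 0 := by
  induction x using induction_of with
  | zero => exact ⟨0, fun _ _ => rfl⟩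
  | of i g => exact ⟨i, fun j hj => coeff_of_ne g (ne_of_gt hj)⟩
  | add x y hx hy =>
    obtain ⟨b, hb⟩ := hx
    obtain ⟨c, hc⟩ := hy
    exact ⟨max b c, fun i hi => by rw [coeff_add, hb i (by omega), hc i (by omega), add_zero]⟩

lemma exists_coeff_eq (x : act.HomStar X Y) (y : ∀ i : ℤ, ShiftedHom X' Y' i)
    (hy : ∀ i, x.coeff act i = 0 → y i = 0) :
    ∃ y' : act.HomStar X' Y', ∀ i, y'.coeff act i = y i := by
  classical
  refine ⟨DFinsupp.mapRange (fun i (z : ShiftedHom X Y i) => if z = 0 then 0 else y i)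
    (fun i => if_pos rfl) (show Π₀ i : ℤ, ShiftedHom X Y i from x), fun i => ?_⟩
  change (DFinsupp.mapRange _ _ _ : Π₀ i : ℤ, ShiftedHom X' Y' i) i = _
  rw [DFinsupp.mapRange_apply]
  split_ifs with h
  · exact (hy i h).symm
  · rfl

lemma smul_of {n : ℕ} (r : 𝒜 n) {i j : ℤ} (g : ShiftedHom X Y i) (h : (n : ℤ) + i = j) :
    r.1 • of act i g = of act j (g.comp (centerApp (act.toCenter n r) Y) h) := by
  ext l
  by_cases hl : l = j
  · subst hl
    rw [coeff_smul act n r _ h, coeff_of_same, coeff_of_same]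
  · rw [coeff_smul act n r _ (show (n : ℤ) + (l - n) = l by ring), coeff_of_ne _ hl,
      coeff_of_ne _ (by omega), ShiftedHom.zero_comp]

variable {m : ℤ} (φ : ∀ i j : ℤ, i + m = j → (ShiftedHom X Y i →+ ShiftedHom X' Y' j))

variable (act) in
/-- The map of degree `m` between graded Hom groups with the given components. -/
noncomputable def gradedMap : act.HomStar X Y →+ act.HomStar X' Y' :=
  DirectSum.toAddMonoid fun i => (DirectSum.of (fun j : ℤ => ShiftedHom X' Y' j) (i + m)).comp
    (φ _ _ rfl)

lemma coeff_gradedMap (x : act.HomStar X Y) {i j : ℤ} (h : i + m = j) :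
    (gradedMap act φ x).coeff act j = φ i j h (x.coeff act i) := by
  subst h
  induction x using induction_of with
  | zero => simp only [map_zero, coeff_zero]
  | of l g =>
    have map_of : gradedMap act φ (of act l g) = of act (l + m) (φ _ _ rfl g) :=
      toAddMonoid_of _ _ _
    rw [map_of]
    obtain rfl | hl := eq_or_ne i l
    · simp only [coeff_of_same]
    · rw [coeff_of_ne _ (by omega), coeff_of_ne _ hl, map_zero]
  | add x y hx hy => rw [map_add, coeff_add, coeff_add, hx, hy, map_add]

end HomStar

open HomStar

lemma homGE_mono {a b : ℤ} (h : a ≤ b) : act.homGE X Y b ≤ act.homGE X Y a :=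
  fun _ hx i hi => hx i (by omega)

lemma of_mem_homGE {n i : ℤ} (h : n ≤ i) (g : ShiftedHom X Y i) :
    HomStar.of act i g ∈ act.homGE X Y n :=
  fun _ hj => coeff_of_ne g (by omega)

lemma of_coeff_mem_homGE {n : ℤ} {x : act.HomStar X Y} (hx : x ∈ act.homGE X Y n) (i : ℤ) :
    HomStar.of act i (x.coeff act i) ∈ act.homGE X Y n := by
  obtain hi | hi := lt_or_ge i n
  · rw [hx i hi, of_zero]
    exact zero_mem _
  · exact of_mem_homGE hi _

section homGEMap

variable {m : ℤ} (φ : ∀ i j : ℤ, i + m = j → (ShiftedHom X Y i →+ ShiftedHom X' Y' j))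
  (hφ : ∀ (n : ℕ) (r : 𝒜 n) (i j k l : ℤ) (hij : i + m = j) (hik : (n : ℤ) + i = k)
    (hkl : k + m = l) (hjl : (n : ℤ) + j = l) (g : ShiftedHom X Y i),
    φ k l hkl (g.comp (centerApp (act.toCenter n r) Y) hik) =
      (φ i j hij g).comp (centerApp (act.toCenter n r) Y') hjl) {a b : ℤ} (hab : a + m = b)

/-- The `R`-linear map between truncations of graded Hom groups that is given by components which
commute with the homogeneous elements of `R`. -/
noncomputable def homGEMap : act.homGE X Y a →ₗ[R] act.homGE X' Y' b :=
  LinearMap.restrict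
    { gradedMap act φ with
      map_smul' := fun r x => by
        change gradedMap act φ (r • x) = r • gradedMap act φ x
        induction r using DirectSum.Decomposition.inductionOn 𝒜 with
        | zero => rw [zero_smul, zero_smul, map_zero]
        | @homogeneous n r =>
          ext l
          rw [coeff_gradedMap φ _ (sub_add_cancel l m),
            coeff_smul act n r x (add_sub_cancel (n : ℤ) (l - m)),
            coeff_smul act n r _ (add_sub_cancel (n : ℤ) l),
            coeff_gradedMap φ x (show l - m - n + m = l - n by ring),
            hφ n r _ _ _ _ _ _ _ (add_sub_cancel (n : ℤ) l)]
        | add r s hr hs => rw [add_smul, add_smul, map_add, hr, hs] }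
    fun x hx j hj => (coeff_gradedMap φ x (sub_add_cancel j m)).trans
      (by rw [hx _ (by omega), map_zero])

lemma coeff_homGEMap (x : act.homGE X Y a) {i j : ℤ} (h : i + m = j) :
    (homGEMap φ hφ hab x).1.coeff act j = φ i j h (x.1.coeff act i) :=
  coeff_gradedMap φ x.1 h

end homGEMap

variable (act Y) in
/-- Precomposition with `α : X' ⟶ ΣᵐX`. -/
noncomputable def precomp {m : ℤ} (α : ShiftedHom X' X m) {a b : ℤ} (hab : a + m = b) :
    act.homGE X Y a →ₗ[R] act.homGE X' Y b :=
  homGEMap (fun _ _ h => AddMonoidHom.mk' (fun g => α.comp g h) fun g g' => α.comp_add g g' h)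
    (fun _ _ _ _ _ _ _ _ _ _ _ => (ShiftedHom.comp_assoc _ _ _ _ _ (by omega)).symm) hab

lemma coeff_precomp {m : ℤ} (α : ShiftedHom X' X m) {a b : ℤ} (hab : a + m = b)
    (x : act.homGE X Y a) {i j : ℤ} (h : i + m = j) :
    (act.precomp Y α hab x).1.coeff act j = α.comp (x.1.coeff act i) h :=
  coeff_homGEMap _ _ hab x h

lemma coeff_precomp_mk₀ (f : X' ⟶ X) {a : ℤ} (x : act.homGE X Y a) (i : ℤ) :
    (act.precomp Y (ShiftedHom.mk₀ (0 : ℤ) rfl f) (add_zero a) x).1.coeff act i =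
      f ≫ x.1.coeff act i := by
  rw [coeff_precomp _ _ x (add_zero i), ShiftedHom.mk₀_comp]

variable (act X) in
/-- Postcomposition with a morphism. -/
noncomputable def postcomp (f : Y ⟶ Y') (a : ℤ) : act.homGE X Y a →ₗ[R] act.homGE X Y' a :=
  homGEMap (m := 0)
    (fun i j h => AddMonoidHom.mk' (fun g => g.comp (ShiftedHom.mk₀ (0 : ℤ) rfl f) (by omega))
      fun g g' => ShiftedHom.add_comp g g' _ _)
    (fun n r i j k l hij hik hkl hjl g => by
      have naturality : (centerApp (act.toCenter n r) Y).comp (ShiftedHom.mk₀ (0 : ℤ) rfl f)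
          (zero_add _) = (ShiftedHom.mk₀ (0 : ℤ) rfl f).comp (centerApp (act.toCenter n r) Y')
            (add_zero _) := by
        rw [ShiftedHom.comp_mk₀, ShiftedHom.mk₀_comp, comp_centerApp_eq_centerApp_comp_map]
      simp only [AddMonoidHom.mk'_apply]
      rw [ShiftedHom.comp_assoc _ _ _ _ (zero_add _) (by omega), naturality,
        ShiftedHom.comp_assoc _ _ _ _ (add_zero _) (by omega)])
    (add_zero a)

lemma coeff_postcomp (f : Y ⟶ Y') {a : ℤ} (x : act.homGE X Y a) (i : ℤ) :
    (act.postcomp X f a x).1.coeff act i = x.1.coeff act i ≫ f⟦i⟧' := by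
  rw [postcomp, coeff_homGEMap _ _ _ x (add_zero i)]
  exact ShiftedHom.comp_mk₀ _ _ rfl _

lemma exact_of_coeff {X'' Y'' : T} {a : ℤ} {F : act.homGE X Y a →ₗ[R] act.homGE X' Y' a}
    {G : act.homGE X' Y' a →ₗ[R] act.homGE X'' Y'' a}
    {φ : ∀ i : ℤ, ShiftedHom X Y i → ShiftedHom X' Y' i}
    {ψ : ∀ i : ℤ, ShiftedHom X' Y' i → ShiftedHom X'' Y'' i}
    (hF : ∀ x i, (F x).1.coeff act i = φ i (x.1.coeff act i))
    (hG : ∀ x i, (G x).1.coeff act i = ψ i (x.1.coeff act i))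
    (hφψ : ∀ i, Function.Exact (φ i) (ψ i)) : Function.Exact F G := by
  have map_zero (i : ℤ) : φ i 0 = 0 := by
    have := hF 0 i
    rw [_root_.map_zero] at this
    exact this.symm
  intro y
  constructor
  · intro hy
    have lift (i : ℤ) : ∃ g, φ i g = y.1.coeff act i ∧ (y.1.coeff act i = 0 → g = 0) := by
      by_cases hi : y.1.coeff act i = 0
      · exact ⟨0, (map_zero i).trans hi.symm, fun _ => rfl⟩
      · obtain ⟨g, hg⟩ := (hφψ i (y.1.coeff act i)).1 (by rw [← hG, hy]; rfl)
        exact ⟨g, hg, fun h => absurd h hi⟩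
    choose g hg hg0 using lift
    obtain ⟨x, hx⟩ := exists_coeff_eq y.1 g hg0
    refine ⟨⟨x, fun i hi => (hx i).trans (hg0 i (y.2 i hi))⟩, Subtype.ext (ext_coeff fun i => ?_)⟩
    rw [hF, hx, hg]
  · rintro ⟨x, rfl⟩
    refine Subtype.ext (ext_coeff fun i => ?_)
    rw [hG, hF]
    exact (hφψ i _).2 ⟨_, rfl⟩

end CentralAction

/-! ### Eventually Noetherian graded Hom groups -/

lemma exists_comp_shift_map_eq_of_distTriang {T : Type*} [Category T] [Preadditive T] [HasShift T ℤ]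
    [∀ n : ℤ, (shiftFunctor T n).Additive] [Limits.HasZeroObject T] [Pretriangulated T]
    {D : Pretriangulated.Triangle T} (hD : D ∈ Pretriangulated.distinguishedTriangles) {X : T}
    (i : ℤ) (g : X ⟶ D.obj₂⟦i⟧) (hg : g ≫ D.mor₂⟦i⟧' = 0) :
    ∃ v : X ⟶ D.obj₁⟦i⟧, v ≫ D.mor₁⟦i⟧' = g := by
  obtain ⟨v, hv⟩ : ∃ v : X ⟶ D.obj₁⟦i⟧, g = v ≫ (i.negOnePow • D.mor₁⟦i⟧') :=
    Pretriangulated.Triangle.coyoneda_exact₂ _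
      (Pretriangulated.Triangle.shift_distinguished D hD i) g (by
        change g ≫ (i.negOnePow • D.mor₂⟦i⟧') = 0
        rw [Linear.comp_units_smul, hg, smul_zero])
  exact ⟨i.negOnePow • v, by rw [hv, Linear.units_smul_comp, Linear.comp_units_smul]⟩

namespace CentralAction

open Pretriangulated HomStar

variable {R : Type*} [Ring R] {T : Type*} [Category T] [Preadditive T] [HasShift T ℤ]
  [∀ n : ℤ, (shiftFunctor T n).Additive] {𝒜 : ℕ → AddSubgroup R} [GradedRing 𝒜]

/-- `Hom^{≥ n}(X, Y)` is Noetherian over `R` for some `n`. -/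
def EventuallyNoetherian (act : CentralAction T 𝒜) (X Y : T) : Prop :=
  ∃ n : ℤ, IsNoetherian R (act.homGE X Y n)

variable {act : CentralAction T 𝒜}

lemma EventuallyNoetherian.exists_ge {X Y : T} (h : act.EventuallyNoetherian X Y) :
    ∃ n : ℤ, ∀ m ≥ n, IsNoetherian R (act.homGE X Y m) := by
  obtain ⟨n, hn⟩ := h
  exact ⟨n, fun m hm => isNoetherian_of_le (homGE_mono hm)⟩

lemma precomp_surjective {X X' : T} {m n : ℤ} {α : ShiftedHom X' X m} {β : ShiftedHom X X' n}
    (hnm : n + m = 0) (h : α.comp β hnm = ShiftedHom.mk₀ 0 rfl (𝟙 X')) (Y : T) {a b : ℤ}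
    (hab : a + m = b) : Function.Surjective (act.precomp Y α hab) := by
  refine fun y => ⟨act.precomp Y β (by omega) y, Subtype.ext (ext_coeff fun i => ?_)⟩
  rw [coeff_precomp α hab _ (sub_add_cancel i m), coeff_precomp β _ y (show i + n = i - m by omega),
    ← ShiftedHom.comp_assoc α β _ hnm _ (by omega), h, ShiftedHom.mk₀_id_comp]

lemma EventuallyNoetherian.of_comp_eq_id {X X' Y : T} (hX : act.EventuallyNoetherian X Y) {m n : ℤ}
    {α : ShiftedHom X' X m} {β : ShiftedHom X X' n} (hnm : n + m = 0)
    (h : α.comp β hnm = ShiftedHom.mk₀ 0 rfl (𝟙 X')) : act.EventuallyNoetherian X' Y := by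
  obtain ⟨a, ha⟩ := hX
  exact ⟨a + m, isNoetherian_of_surjective _
    (LinearMap.range_eq_top.2 (precomp_surjective hnm h Y rfl))⟩

lemma EventuallyNoetherian.of_retract_left {X X' Y : T} (h : act.EventuallyNoetherian X Y)
    (r : Retract X' X) : act.EventuallyNoetherian X' Y :=
  h.of_comp_eq_id (α := ShiftedHom.mk₀ 0 rfl r.i) (β := ShiftedHom.mk₀ 0 rfl r.r) (add_zero 0)
    (by rw [ShiftedHom.mk₀_comp_mk₀, r.retract])

lemma EventuallyNoetherian.shift_left {X Y : T} (h : act.EventuallyNoetherian X Y) (m : ℤ) :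
    act.EventuallyNoetherian (X⟦m⟧) Y := by
  obtain ⟨α, β, hαβ⟩ := exists_shiftedHom_comp_eq_id X m
  exact h.of_comp_eq_id _ hαβ

lemma EventuallyNoetherian.of_retract_right {X Y Y' : T} (h : act.EventuallyNoetherian X Y)
    (r : Retract Y' Y) : act.EventuallyNoetherian X Y' := by
  obtain ⟨a, ha⟩ := h
  refine ⟨a, isNoetherian_of_surjective (act.postcomp X r.r a)
    (LinearMap.range_eq_top.2 fun y => ⟨act.postcomp X r.i a y,
      Subtype.ext (ext_coeff fun i => ?_)⟩)⟩
  rw [coeff_postcomp, coeff_postcomp, Category.assoc, ← Functor.map_comp, r.retract,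
    CategoryTheory.Functor.map_id, Category.comp_id]

lemma eventuallyNoetherian_of_exact {X₁ X₂ X₃ Y₁ Y₂ Y₃ : T} (h₁ : act.EventuallyNoetherian X₁ Y₁)
    (h₃ : act.EventuallyNoetherian X₃ Y₃)
    (F : ∀ a, act.homGE X₁ Y₁ a →ₗ[R] act.homGE X₂ Y₂ a)
    (G : ∀ a, act.homGE X₂ Y₂ a →ₗ[R] act.homGE X₃ Y₃ a)
    (hFG : ∀ a, Function.Exact (F a) (G a)) : act.EventuallyNoetherian X₂ Y₂ := by
  obtain ⟨a₁, h₁⟩ := h₁.exists_ge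
  obtain ⟨a₃, h₃⟩ := h₃.exists_ge
  have := h₁ (max a₁ a₃) (le_max_left _ _)
  have := h₃ (max a₁ a₃) (le_max_right _ _)
  exact ⟨max a₁ a₃, isNoetherian_of_range_eq_ker _ _ (hFG _).linearMap_ker_eq.symm⟩

variable [Limits.HasZeroObject T] [Pretriangulated T]

lemma exact_precomp_of_distTriang {D : Triangle T} (hD : D ∈ distTriang T) (Y : T) (a : ℤ) :
    Function.Exact (act.precomp Y (ShiftedHom.mk₀ (0 : ℤ) rfl D.mor₂) (add_zero a))
      (act.precomp Y (ShiftedHom.mk₀ (0 : ℤ) rfl D.mor₁) (add_zero a)) := by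
  refine exact_of_coeff (φ := fun i (g : D.obj₃ ⟶ Y⟦i⟧) => D.mor₂ ≫ g)
    (ψ := fun i (g : D.obj₂ ⟶ Y⟦i⟧) => D.mor₁ ≫ g) (coeff_precomp_mk₀ _) (coeff_precomp_mk₀ _)
    fun i g => ⟨fun hg => ?_, ?_⟩
  · obtain ⟨v, hv⟩ := Triangle.yoneda_exact₂ D hD g hg
    exact ⟨v, hv.symm⟩
  · rintro ⟨v, rfl⟩
    exact (comp_distTriang_mor_zero₁₂_assoc _ hD _).trans Limits.zero_comp

lemma exact_postcomp_of_distTriang {D : Triangle T} (hD : D ∈ distTriang T) (X : T) (a : ℤ) :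
    Function.Exact (act.postcomp X D.mor₁ a) (act.postcomp X D.mor₂ a) := by
  refine exact_of_coeff (φ := fun i (g : X ⟶ D.obj₁⟦i⟧) => g ≫ D.mor₁⟦i⟧')
    (ψ := fun i (g : X ⟶ D.obj₂⟦i⟧) => g ≫ D.mor₂⟦i⟧') (coeff_postcomp _) (coeff_postcomp _)
    fun i g => ⟨fun hg => exists_comp_shift_map_eq_of_distTriang hD i g hg, ?_⟩
  rintro ⟨v, rfl⟩
  simp only [Category.assoc, ← Functor.map_comp, comp_distTriang_mor_zero₁₂ _ hD,
    Functor.map_zero, Limits.comp_zero]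

lemma EventuallyNoetherian.of_distTriang_left {D : Triangle T} (hD : D ∈ distTriang T) {Y : T}
    (h₁ : act.EventuallyNoetherian D.obj₁ Y) (h₃ : act.EventuallyNoetherian D.obj₃ Y) :
    act.EventuallyNoetherian D.obj₂ Y :=
  eventuallyNoetherian_of_exact h₃ h₁ _ _ (exact_precomp_of_distTriang hD Y)

lemma EventuallyNoetherian.of_distTriang_right {D : Triangle T} (hD : D ∈ distTriang T) {X : T}
    (h₁ : act.EventuallyNoetherian X D.obj₁) (h₃ : act.EventuallyNoetherian X D.obj₃) :
    act.EventuallyNoetherian X D.obj₂ :=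
  eventuallyNoetherian_of_exact h₁ h₃ _ _ (exact_postcomp_of_distTriang hD X)

end CentralAction

/-! ### Restriction to the even part -/

namespace CentralAction

variable {R : Type*} [Ring R] {T : Type*} [Category T] [Preadditive T] [HasShift T ℤ]
  [∀ n : ℤ, (shiftFunctor T n).Additive] {𝒜 : ℕ → AddSubgroup R} [GradedRing 𝒜]
  {act : CentralAction T 𝒜} {X Y : T}

open HomStar

variable (act X Y) in
/-- `Hom^{≥ b}(X, Y)` as a module over the even part of `R`. -/
noncomputable def evenHomGE (b : ℤ) : Submodule (evenCenter 𝒜) (act.HomStar X Y) :=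
  (act.homGE X Y b).restrictScalars (evenCenter 𝒜)

lemma mem_evenHomGE {b : ℤ} {x : act.HomStar X Y} :
    x ∈ act.evenHomGE X Y b ↔ x ∈ act.homGE X Y b :=
  Iff.rfl

/-- Linear maps over `R` are linear over the even part. -/
noncomputable def evenHomGEMap {X' Y' : T} {b c : ℤ} (F : act.homGE X Y b →ₗ[R] act.homGE X' Y' c) :
    act.evenHomGE X Y b →ₗ[evenCenter 𝒜] act.evenHomGE X' Y' c where
  toFun x := F x
  map_add' := F.map_add
  map_smul' e := F.map_smul (e : R)

lemma evenHomGEMap_surjective {X' Y' : T} {b c : ℤ} {F : act.homGE X Y b →ₗ[R] act.homGE X' Y' c}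
    (hF : Function.Surjective F) : Function.Surjective (evenHomGEMap F) :=
  hF

lemma exact_evenHomGEMap {X' Y' X'' Y'' : T} {b c d : ℤ}
    {F : act.homGE X Y b →ₗ[R] act.homGE X' Y' c} {G : act.homGE X' Y' c →ₗ[R] act.homGE X'' Y'' d}
    (hFG : Function.Exact F G) : Function.Exact (evenHomGEMap F) (evenHomGEMap G) :=
  hFG

variable (act X Y) in
/-- The projection of `Hom*(X, Y)` onto its homogeneous components of degree congruent to `ε`
modulo `2`. -/
noncomputable def parityProj (ε : ℤ) : act.HomStar X Y →+ act.HomStar X Y :=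
  DFinsupp.filterAddMonoidHom (fun i : ℤ => ShiftedHom X Y i) fun i => i % 2 = ε

lemma coeff_parityProj (ε : ℤ) (x : act.HomStar X Y) (i : ℤ) :
    (act.parityProj X Y ε x).coeff act i = if i % 2 = ε then x.coeff act i else 0 :=
  DFinsupp.filter_apply (β := fun i : ℤ => ShiftedHom X Y i) (fun i => i % 2 = ε) i x

lemma parityProj_smul_of_even (ε : ℤ) {n : ℕ} (hn : Even n) (r : 𝒜 n) (x : act.HomStar X Y) :
    act.parityProj X Y ε (r.1 • x) = r.1 • act.parityProj X Y ε x := by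
  ext i
  have hi : (n : ℤ) + (i - n) = i := by ring
  have parity : (i - n) % 2 = i % 2 := by
    have := (Int.even_coe_nat n).2 hn
    rw [Int.even_iff] at this
    omega
  rw [coeff_smul act n r _ hi, coeff_parityProj, coeff_parityProj, coeff_smul act n r x hi, parity]
  split_ifs
  · rfl
  · rw [ShiftedHom.zero_comp]

lemma parityProj_smul_parityProj_of_odd (ε : ℤ) {n : ℕ} (hn : Odd n) (r : 𝒜 n)
    (x : act.HomStar X Y) : act.parityProj X Y ε (r.1 • act.parityProj X Y ε x) = 0 := by
  ext i
  have hi : (n : ℤ) + (i - n) = i := by ring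
  rw [coeff_parityProj, coeff_smul act n r _ hi, coeff_parityProj, coeff_zero]
  split_ifs with h h'
  · have := (Int.odd_coe_nat n).2 hn
    rw [Int.odd_iff] at this
    omega
  · rw [ShiftedHom.zero_comp]
  · rfl

variable (act X Y) in
/-- The restriction of `parityProj` to `Hom^{≥ b}(X, Y)`, linear over the even part of `R`. -/
noncomputable def evenHomGEParityProj (ε b : ℤ) :
    act.evenHomGE X Y b →ₗ[evenCenter 𝒜] act.evenHomGE X Y b where
  toFun x := ⟨act.parityProj X Y ε x, fun i hi => by
    rw [coeff_parityProj, x.2 i hi, ite_self]⟩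
  map_add' x y := Subtype.ext (map_add _ x.1 y.1)
  map_smul' e x := Subtype.ext <| evenCenter_induction
    (motive := fun r : R => act.parityProj X Y ε (r • x.1) = r • act.parityProj X Y ε x.1)
    (fun r hn => parityProj_smul_of_even ε hn r x.1)
    (fun r s hr hs => by rw [add_smul, add_smul, map_add, hr, hs]) e

lemma parityProj_parityProj (ε : ℤ) (x : act.HomStar X Y) :
    act.parityProj X Y ε (act.parityProj X Y ε x) = act.parityProj X Y ε x := by
  ext i
  rw [coeff_parityProj, coeff_parityProj]
  split_ifs <;> rfl

variable (act X Y) in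
lemma exists_parityProj_smul_parityProj_eq (hR : IsGradedCommutative 𝒜) (ε : ℤ) (r : R) :
    ∃ e : evenCenter 𝒜, ∀ x, act.parityProj X Y ε (r • act.parityProj X Y ε x) =
      e • act.parityProj X Y ε x := by
  induction r using DirectSum.Decomposition.inductionOn 𝒜 with
  | zero => exact ⟨0, fun x => by rw [zero_smul, zero_smul, map_zero]⟩
  | @homogeneous n r =>
    obtain hn | hn := n.even_or_odd
    · refine ⟨hR.toEvenCenter hn r, fun x => ?_⟩
      rw [parityProj_smul_of_even ε hn, parityProj_parityProj]
      rfl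
    · exact ⟨0, fun x => by rw [parityProj_smul_parityProj_of_odd ε hn, zero_smul]⟩
  | add r s hr hs =>
    obtain ⟨d, hd⟩ := hr
    obtain ⟨e, he⟩ := hs
    exact ⟨d + e, fun x => by rw [add_smul, add_smul, map_add, hd, he]⟩

lemma parityProj_zero_add_parityProj_one (x : act.HomStar X Y) :
    act.parityProj X Y 0 x + act.parityProj X Y 1 x = x := by
  ext i
  rw [coeff_add, coeff_parityProj, coeff_parityProj]
  obtain h | h := Int.emod_two_eq_zero_or_one i <;> simp [h]

variable (act X Y) in
lemma isNoetherian_evenHomGE (hR : IsGradedCommutative 𝒜) (b : ℤ)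
    [IsNoetherian R (act.homGE X Y b)] : IsNoetherian (evenCenter 𝒜) (act.evenHomGE X Y b) := by
  let : Module R (act.evenHomGE X Y b) := (act.homGE X Y b).module
  have : IsNoetherian R (act.evenHomGE X Y b) := ‹IsNoetherian R (act.homGE X Y b)›
  have range_noetherian (ε : ℤ) :
      IsNoetherian (evenCenter 𝒜) (LinearMap.range (act.evenHomGEParityProj X Y ε b)) :=
    isNoetherian_range_of_isIdempotentElem (R := R)
      (LinearMap.ext fun x => Subtype.ext (parityProj_parityProj ε x.1)) fun r => by
        obtain ⟨e, he⟩ := act.exists_parityProj_smul_parityProj_eq X Y hR ε r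
        exact ⟨e, fun x => Subtype.ext (he x.1)⟩
  have range_sup : LinearMap.range (act.evenHomGEParityProj X Y 0 b) ⊔
      LinearMap.range (act.evenHomGEParityProj X Y 1 b) = ⊤ :=
    Submodule.eq_top_iff'.2 fun x => Submodule.mem_sup.2
      ⟨_, ⟨x, rfl⟩, _, ⟨x, rfl⟩, Subtype.ext (parityProj_zero_add_parityProj_one x.1)⟩
  rw [← isNoetherian_top_iff, ← range_sup]
  infer_instance

-- Otherwise unification compares the actions of `R` and of its even part by unfolding them.
attribute [irreducible] evenHomGE

end CentralAction

/-! ### Vanishing of shifted Hom groups -/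

/-- `Hom(X, ΣⁱY)` vanishes for all `i ≥ a`. -/
def HomVanishesFrom {T : Type*} [Category T] [Preadditive T] [HasShift T ℤ] (X Y : T) (a : ℤ) :
    Prop :=
  ∀ i ≥ a, ∀ g : ShiftedHom X Y i, g = 0

namespace HomVanishesFrom

open Pretriangulated

variable {T : Type*} [Category T] [Preadditive T] [HasShift T ℤ] {X Y : T} {a b : ℤ}

lemma mono (h : HomVanishesFrom X Y a) (hab : a ≤ b) : HomVanishesFrom X Y b :=
  fun i hi => h i (hab.trans hi)

lemma of_retract_left {X' : T} (h : HomVanishesFrom X Y a) (r : Retract X' X) :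
    HomVanishesFrom X' Y a := fun i hi g => by
  rw [← Category.id_comp g, ← r.retract, Category.assoc, h i hi (r.r ≫ g), Limits.comp_zero]

lemma shift_right {m : ℤ} (h : HomVanishesFrom X Y (a + m)) : HomVanishesFrom X (Y⟦m⟧) a := by
  intro i hi g
  rw [← cancel_mono ((shiftFunctorAdd' T m i (i + m) (add_comm m i)).inv.app Y),
    h (i + m) (by omega) (g ≫ (shiftFunctorAdd' T m i (i + m) (add_comm m i)).inv.app Y),
    Limits.zero_comp]

lemma of_retract_right {Y' : T} (h : HomVanishesFrom X Y a) (r : Retract Y' Y) :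
    HomVanishesFrom X Y' a := fun i hi g => by
  rw [← Category.comp_id g, ← CategoryTheory.Functor.map_id, ← r.retract, Functor.map_comp,
    ← Category.assoc, h i hi (g ≫ r.i⟦i⟧'), Limits.zero_comp]

variable [∀ n : ℤ, (shiftFunctor T n).Additive]

lemma of_id_eq_sum {Z : T} {ι : Type*} (h : HomVanishesFrom X Z a) (s : Finset ι)
    (f : ι → (Y ⟶ Z)) (g : ι → (Z ⟶ Y)) (hfg : 𝟙 Y = ∑ t ∈ s, f t ≫ g t) :
    HomVanishesFrom X Y a := fun i hi u => by
  rw [← Category.comp_id u, ← CategoryTheory.Functor.map_id, hfg, Functor.map_sum,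
    Preadditive.comp_sum]
  refine Finset.sum_eq_zero fun t _ => ?_
  rw [Functor.map_comp, ← Category.assoc, h i hi (u ≫ (f t)⟦i⟧'), Limits.zero_comp]

lemma shift (h : HomVanishesFrom X Y a) (m : ℤ) : HomVanishesFrom (X⟦m⟧) Y (a + m) := by
  intro i hi g
  obtain ⟨σ, τ, hστ⟩ := exists_shiftedHom_comp_eq_id X m
  rw [← ShiftedHom.mk₀_id_comp (0 : ℤ) rfl g, ← hστ,
    ShiftedHom.comp_assoc σ τ g (neg_add_cancel m) rfl (by omega),
    h (i + -m) (by omega) (τ.comp g rfl), ShiftedHom.comp_zero]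

variable [Limits.HasZeroObject T] [Pretriangulated T]

lemma of_distTriang_left {D : Triangle T} (hD : D ∈ distTriang T)
    (h₁ : HomVanishesFrom D.obj₁ Y a) (h₃ : HomVanishesFrom D.obj₃ Y a) :
    HomVanishesFrom D.obj₂ Y a := fun i hi g => by
  obtain ⟨v, rfl⟩ : ∃ v, g = D.mor₂ ≫ v := Triangle.yoneda_exact₂ _ hD g (h₁ i hi _)
  rw [h₃ i hi v, Limits.comp_zero]

lemma of_distTriang_right {D : Triangle T} (hD : D ∈ distTriang T)
    (h₁ : HomVanishesFrom X D.obj₁ a) (h₃ : HomVanishesFrom X D.obj₃ a) :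
    HomVanishesFrom X D.obj₂ a := fun i hi g => by
  obtain ⟨v, rfl⟩ := exists_comp_shift_map_eq_of_distTriang hD i g (h₃ i hi _)
  rw [h₁ i hi v, Limits.zero_comp]

lemma of_distTriang_obj₃_right {D : Triangle T} (hD : D ∈ distTriang T)
    (h₁ : HomVanishesFrom X D.obj₁ (a + 1)) (h₂ : HomVanishesFrom X D.obj₂ a) :
    HomVanishesFrom X D.obj₃ a :=
  of_distTriang_right (rot_of_distTriang _ hD) h₂ h₁.shift_right

variable {K : T} {n : ℕ} {f : X ⟶ X⟦(n : ℤ)⟧} {j : X⟦(n : ℤ)⟧ ⟶ K} {p : K ⟶ X⟦(1 : ℤ)⟧}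

lemma cone (h : HomVanishesFrom X Y a) (hn : 0 < n)
    (hD : Triangle.mk f j p ∈ distTriang T) : HomVanishesFrom K Y (a + n) :=
  of_distTriang_left (rot_of_distTriang _ hD) (h.shift n) ((h.shift 1).mono (by omega))

lemma of_cone (h : HomVanishesFrom X Y b) (hn : 0 < n) (hD : Triangle.mk f j p ∈ distTriang T)
    (hK : HomVanishesFrom K Y (a + n)) : HomVanishesFrom X Y a := by
  have step (c : ℤ) (hac : a ≤ c) (hc : HomVanishesFrom X Y (c + 1)) : HomVanishesFrom X Y c := by
    intro i hi g
    obtain ⟨v, hv⟩ : ∃ v : K ⟶ Y⟦i + n⟧,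
        g⟦(n : ℤ)⟧' ≫ (shiftFunctorAdd T i n).inv.app Y = j ≫ v :=
      Triangle.yoneda_exact₂ _ hD _ (hc (i + n) (by omega) _)
    rw [hK (i + n) (by omega) v, Limits.comp_zero] at hv
    apply (shiftFunctor T (n : ℤ)).map_injective
    rw [Functor.map_zero, ← cancel_mono ((shiftFunctorAdd T i n).inv.app Y), Limits.zero_comp, hv]
  refine Int.leInductionDown (motive := fun c _ => a ≤ c → HomVanishesFrom X Y c)
    (fun _ => h.mono (le_max_right a b)) (fun c _ ih hc => ?_) a (le_max_left a b) le_rfl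
  exact step (c - 1) hc (by rw [sub_add_cancel]; exact ih (by omega))

end HomVanishesFrom

/-! ### Cones of central elements -/

namespace CentralAction

open Pretriangulated HomStar Module

variable {R : Type*} [Ring R] {T : Type*} [Category T] [Preadditive T] [HasShift T ℤ]
  [∀ n : ℤ, (shiftFunctor T n).Additive] {𝒜 : ℕ → AddSubgroup R} [GradedRing 𝒜]
  {act : CentralAction T 𝒜} {X Y : T}

lemma evenHomGE_mono {b c : ℤ} (h : b ≤ c) : act.evenHomGE X Y c ≤ act.evenHomGE X Y b :=
  fun _ hx => mem_evenHomGE.2 (homGE_mono h (mem_evenHomGE.1 hx))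

variable (act X Y) in
/-- Beyond the degrees of finitely many generators, only coefficients of positive degree
contribute. -/
lemma exists_evenHomGE_le_irrelevant_smul (hR : IsGradedCommutative 𝒜) (b : ℤ)
    [IsNoetherian (evenCenter 𝒜) (act.evenHomGE X Y b)] :
    ∃ c ≥ b, act.evenHomGE X Y c ≤ evenIrrelevantIdeal 𝒜 • act.evenHomGE X Y b := by
  classical
  obtain ⟨t, ht⟩ : (act.evenHomGE X Y b).FG :=
    Module.Finite.iff_fg.1 inferInstance
  choose d hd using fun w : act.HomStar X Y => w.exists_coeff_eq_zero_of_gt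
  obtain ⟨B, hB⟩ := (t.image d).exists_le
  have component_mem (x : act.HomStar X Y) (hx : x ∈ act.evenHomGE X Y b) (i : ℤ) (hi : i > B) :
      of act i (x.coeff act i) ∈ evenIrrelevantIdeal 𝒜 • act.evenHomGE X Y b := by
    rw [← ht] at hx
    induction hx using Submodule.closure_induction with
    | zero => rw [coeff_zero, of_zero]; exact zero_mem _
    | add x y _ _ hx hy => rw [coeff_add, of_add]; exact add_mem hx hy
    | smul_mem e w hw =>
      have hwb : w ∈ act.homGE X Y b := by
        rw [← mem_evenHomGE, ← ht]
        exact Submodule.subset_span hw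
      refine evenCenter_induction (motive := fun r : R => of act i ((r • w).coeff act i) ∈
        evenIrrelevantIdeal 𝒜 • act.evenHomGE X Y b) (fun {n} r hn => ?_)
        (fun r s hr hs => by rw [add_smul, coeff_add, of_add]; exact add_mem hr hs) e
      have hi' : (n : ℤ) + (i - n) = i := by ring
      rw [coeff_smul act n r w hi']
      obtain rfl | hn' := n.eq_zero_or_pos
      · rw [hd w _ (by have := hB _ (Finset.mem_image_of_mem d hw); omega), ShiftedHom.zero_comp,
          of_zero]
        exact zero_mem _
      · rw [← smul_of r _ hi']
        exact Submodule.smul_mem_smul (r := hR.toEvenCenter hn r)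
          (Ideal.subset_span ⟨n, hn, hn', r.2⟩) (mem_evenHomGE.2 (of_coeff_mem_homGE hwb _))
  refine ⟨max b (B + 1), le_max_left _ _, fun x hx => ?_⟩
  refine mem_of_forall_of_coeff_mem
    (S := (evenIrrelevantIdeal 𝒜 • act.evenHomGE X Y b).toAddSubmonoid) fun i => ?_
  obtain hi | hi := lt_or_ge i (max b (B + 1))
  · rw [mem_evenHomGE.1 hx i hi, of_zero]
    exact zero_mem _
  · exact component_mem x (evenHomGE_mono (le_max_left _ _) hx) i (by omega)

variable (act X Y) in
lemma exists_evenHomGE_le_irrelevant_pow_smul (hR : IsGradedCommutative 𝒜) (b : ℤ)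
    [IsNoetherian (evenCenter 𝒜) (act.evenHomGE X Y b)] (k : ℕ) :
    ∃ c ≥ b, act.evenHomGE X Y c ≤ evenIrrelevantIdeal 𝒜 ^ k • act.evenHomGE X Y b := by
  induction k with
  | zero => exact ⟨b, le_rfl, by rw [pow_zero, Ideal.one_eq_top, Submodule.top_smul]⟩
  | succ k ih =>
    obtain ⟨c, hbc, hc⟩ := ih
    have : IsNoetherian (evenCenter 𝒜) (act.evenHomGE X Y c) :=
      isNoetherian_of_le (evenHomGE_mono hbc)
    obtain ⟨d, hcd, hd⟩ := act.exists_evenHomGE_le_irrelevant_smul X Y hR c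
    refine ⟨d, hbc.trans hcd, hd.trans ?_⟩
    rw [pow_succ', Submodule.mul_smul]
    exact Submodule.smul_mono le_rfl hc

lemma homVanishesFrom_of_le_radical_annihilator (hR : IsGradedCommutative 𝒜) {b : ℤ}
    [IsNoetherian (evenCenter 𝒜) (act.evenHomGE X Y b)]
    (h : evenIrrelevantIdeal 𝒜 ≤ (annihilator (evenCenter 𝒜) (act.evenHomGE X Y b)).radical) :
    ∃ a, HomVanishesFrom X Y a := by
  obtain ⟨k, hk⟩ := exists_pow_le_annihilator_of_le_radical _ h
  obtain ⟨c, -, hc⟩ := act.exists_evenHomGE_le_irrelevant_pow_smul X Y hR b k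
  have smul_eq_bot : evenIrrelevantIdeal 𝒜 ^ k • act.evenHomGE X Y b = ⊥ :=
    le_bot_iff.1 <| Submodule.smul_le.2 fun e he x hx =>
      congrArg Subtype.val (mem_annihilator.1 (hk he) ⟨x, hx⟩)
  refine ⟨c, fun i hi g => ?_⟩
  have of_eq_zero : of act i g = 0 :=
    (Submodule.mem_bot _).1 (smul_eq_bot ▸ hc (mem_evenHomGE.2 (of_mem_homGE hi g)))
  rw [← coeff_of_same (act := act) i g, of_eq_zero, coeff_zero]

lemma evenIrrelevantIdeal_le_annihilator (act : CentralAction T 𝒜) (X : T)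
    (h : HomVanishesFrom Y Y 1) (b : ℤ) :
    evenIrrelevantIdeal 𝒜 ≤ annihilator (evenCenter 𝒜) (act.evenHomGE X Y b) := by
  refine Ideal.span_le.2 fun z ⟨n, _, hn, hz⟩ => mem_annihilator.2 fun x =>
    Subtype.ext (ext_coeff fun i => ?_)
  change ((⟨z, hz⟩ : 𝒜 n).1 • x.1).coeff act i = 0
  rw [coeff_smul act n _ x.1 (add_sub_cancel (n : ℤ) i), h n (by omega) (centerApp _ Y),
    ShiftedHom.comp_zero]

lemma annihilator_evenHomGE_mono {b c : ℤ} (h : b ≤ c) :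
    annihilator (evenCenter 𝒜) (act.evenHomGE X Y b) ≤
      annihilator (evenCenter 𝒜) (act.evenHomGE X Y c) :=
  LinearMap.annihilator_le_of_injective
    (Submodule.inclusion (evenHomGE_mono h)) (Submodule.inclusion_injective _)

lemma annihilator_evenHomGE_le_shift {b c : ℤ} (m : ℤ) (h : b + m ≤ c) :
    annihilator (evenCenter 𝒜) (act.evenHomGE X Y b) ≤
      annihilator (evenCenter 𝒜) (act.evenHomGE (X⟦m⟧) Y c) := by
  obtain ⟨α, β, hαβ⟩ := exists_shiftedHom_comp_eq_id X m
  exact (LinearMap.annihilator_le_of_surjective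
    (evenHomGEMap (act.precomp Y α rfl))
    (evenHomGEMap_surjective (precomp_surjective _ hαβ Y rfl))).trans (annihilator_evenHomGE_mono h)

variable [Limits.HasZeroObject T] [Pretriangulated T]

lemma annihilator_mul_annihilator_le_cone {n : ℕ} (hn : 0 < n) {f : X ⟶ X⟦(n : ℤ)⟧} {K : T}
    {j : X⟦(n : ℤ)⟧ ⟶ K} {p : K ⟶ X⟦(1 : ℤ)⟧} (hD : Triangle.mk f j p ∈ distTriang T) {b c : ℤ}
    (hc : b + n ≤ c) :
    annihilator (evenCenter 𝒜) (act.evenHomGE X Y b) *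
        annihilator (evenCenter 𝒜) (act.evenHomGE X Y b) ≤
      annihilator (evenCenter 𝒜) (act.evenHomGE K Y c) :=
  (Ideal.mul_mono (annihilator_evenHomGE_le_shift 1 (by omega))
    (annihilator_evenHomGE_le_shift (n : ℤ) hc)).trans
  (annihilator_mul_annihilator_le_of_exact
    (f := evenHomGEMap (act.precomp Y (ShiftedHom.mk₀ (0 : ℤ) rfl p) (add_zero c)))
    (g := evenHomGEMap (act.precomp Y (ShiftedHom.mk₀ (0 : ℤ) rfl j) (add_zero c)))
    (exact_evenHomGEMap (exact_precomp_of_distTriang (rot_of_distTriang _ hD) Y c)))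

lemma toEvenCenter_sq_mem_annihilator_cone (hR : IsGradedCommutative 𝒜) {n : ℕ} (hn : Even n)
    (r : 𝒜 n) {K : T} {j : X⟦(n : ℤ)⟧ ⟶ K} {p : K ⟶ X⟦(1 : ℤ)⟧}
    (hD : Triangle.mk (centerApp (act.toCenter n r) X) j p ∈ distTriang T) {c : ℤ} (hc : 0 ≤ c) :
    hR.toEvenCenter hn r ^ 2 ∈ annihilator (evenCenter 𝒜) (act.evenHomGE K Y c) := by
  refine mem_annihilator.2 fun x => Subtype.ext (ext_coeff fun i => ?_)
  rw [sq, mul_smul]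
  change (r.1 • r.1 • x.1).coeff act i = 0
  obtain hi | ⟨m, rfl⟩ : i - n - n < 0 ∨ ∃ m : ℕ, i = n + (n + m) := by
    by_cases hi : i - n - n < 0
    · exact Or.inl hi
    · exact Or.inr ⟨(i - n - n).toNat, by omega⟩
  · rw [coeff_smul act n r _ (show (n : ℤ) + (i - n) = i by ring),
      coeff_smul act n r x.1 (show (n : ℤ) + (i - n - n) = i - n by ring),
      mem_evenHomGE.1 x.2 _ (by omega), ShiftedHom.zero_comp, ShiftedHom.zero_comp]
  · have hn' : Even (n : ℤ) := (Int.even_coe_nat n).2 hn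
    rw [coeff_smul act n r _ rfl, coeff_smul act n r x.1 rfl,
      shiftedHom_comp_centerApp hn' _ _ rfl,
      shiftedHom_comp_centerApp hn' _ _ rfl, ← ShiftedHom.comp_assoc _ _ _ rfl _ (by omega),
      centerApp_comp_self_eq_zero_of_cone hn _ hD, ShiftedHom.zero_comp]

lemma annihilator_sup_span_insert_le_radical_cone (hR : IsGradedCommutative 𝒜) {n : ℕ}
    (hn : Even n) (hpos : 0 < n) (r : 𝒜 n) (t : Set (evenCenter 𝒜)) {K : T}
    {j : X⟦(n : ℤ)⟧ ⟶ K} {p : K ⟶ X⟦(1 : ℤ)⟧}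
    (hD : Triangle.mk (centerApp (act.toCenter n r) X) j p ∈ distTriang T) {b c : ℤ}
    (hbc : b + n ≤ c) (hc : 0 ≤ c) :
    annihilator (evenCenter 𝒜) (act.evenHomGE X Y b) ⊔
        Ideal.span (insert (hR.toEvenCenter hn r) t) ≤
      (annihilator (evenCenter 𝒜) (act.evenHomGE K Y c) ⊔ Ideal.span t).radical := by
  rw [Ideal.span_insert, sup_le_iff, sup_le_iff, Ideal.span_singleton_le_iff_mem]
  refine ⟨fun y hy => ⟨2, Ideal.mem_sup_left ?_⟩, ⟨2, Ideal.mem_sup_left ?_⟩,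
    le_sup_right.trans Ideal.le_radical⟩
  · rw [sq]
    exact annihilator_mul_annihilator_le_cone hpos hD hbc (Ideal.mul_mem_mul hy hy)
  · exact toEvenCenter_sq_mem_annihilator_cone hR hn r hD hc

/-- Dévissage by cones of central elements: taking the cone of `r` on `X` makes `r` nilpotent on
`Hom^{≥ b}(X, Y)`, so that after finitely many steps the whole positive even part is nilpotent. -/
theorem EventuallyNoetherian.cone_induction (hR : IsGradedCommutative 𝒜) {Q : T → Prop}
    (h : act.EventuallyNoetherian X Y) (base : ∀ K a, HomVanishesFrom K Y a → Q K)
    (step : ∀ {X K : T} {n : ℕ} {f : X ⟶ X⟦(n : ℤ)⟧} {j : X⟦(n : ℤ)⟧ ⟶ K} {p : K ⟶ X⟦(1 : ℤ)⟧},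
      0 < n → Triangle.mk f j p ∈ distTriang T → Q K → Q X) : Q X := by
  classical
  have key (t : Finset (evenCenter 𝒜)) (ht : ∀ z ∈ t, ∃ n : ℕ, Even n ∧ 0 < n ∧ (z : R) ∈ 𝒜 n) :
      ∀ (X : T) (b : ℤ), act.EventuallyNoetherian X Y →
        evenIrrelevantIdeal 𝒜 ≤
          (annihilator (evenCenter 𝒜) (act.evenHomGE X Y b) ⊔ Ideal.span t).radical → Q X := by
    induction t using Finset.induction_on with
    | empty =>
      intro X b hX hb
      obtain ⟨c, hc⟩ := hX.exists_ge
      have := hc (max b c) (le_max_right _ _)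
      have := act.isNoetherian_evenHomGE X Y hR (max b c)
      rw [Finset.coe_empty, Ideal.span_empty, sup_bot_eq] at hb
      obtain ⟨a, ha⟩ := homVanishesFrom_of_le_radical_annihilator hR
        (hb.trans (Ideal.radical_mono (annihilator_evenHomGE_mono (le_max_left b c))))
      exact base X a ha
    | insert z t _ ih =>
      intro X b hX hb
      obtain ⟨n, hn, hpos, hz⟩ := ht z (Finset.mem_insert_self z t)
      obtain ⟨K, j, p, hD⟩ := distinguished_cocone_triangle (centerApp (act.toCenter n ⟨z, hz⟩) X)
      have hK : act.EventuallyNoetherian K Y :=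
        .of_distTriang_left (rot_of_distTriang _ hD) (hX.shift_left n) (hX.shift_left 1)
      refine step hpos hD (ih (fun y hy => ht y (Finset.mem_insert_of_mem hy)) K (max (b + n) 0) hK
        (hb.trans ?_))
      rw [Ideal.radical_le_radical_iff, Finset.coe_insert]
      exact annihilator_sup_span_insert_le_radical_cone hR hn hpos ⟨z, hz⟩ t hD
        (le_max_left _ _) (le_max_right _ _)
  obtain ⟨b, hb⟩ := h
  have := act.isNoetherian_evenHomGE X Y hR b
  obtain ⟨t, ht, hspan⟩ := exists_finset_span_le_span_sup_annihilator (act.evenHomGE X Y b)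
    {z : evenCenter 𝒜 | ∃ n : ℕ, Even n ∧ 0 < n ∧ (z : R) ∈ 𝒜 n}
  exact key t ht X b ⟨b, ‹_›⟩ ((hspan.trans (sup_comm _ _).le).trans Ideal.le_radical)

end CentralAction

/-! ### Finitely generated modules -/

section FiniteModules

variable {Λ : Type u} [Ring Λ]

variable (Λ) in
/-- The module `Λ/𝔯`, where `𝔯` is the Jacobson radical of `Λ`. -/
abbrev radicalQuotient : ModuleCat.{u} Λ := ModuleCat.of Λ (Λ ⧸ Ring.jacobson Λ)

/-- The sequence `0 → N → M → M/N → 0` of a submodule `N` of `M`. -/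
def submoduleShortComplex {M : Type u} [AddCommGroup M] [Module Λ M] (N : Submodule Λ M) :
    ShortComplex (ModuleCat.{u} Λ) :=
  ModuleCat.shortComplexOfCompEqZero N.subtype N.mkQ
    (LinearMap.exact_subtype_mkQ N).linearMap_comp_eq_zero

lemma submoduleShortComplex_shortExact {M : Type u} [AddCommGroup M] [Module Λ M]
    (N : Submodule Λ M) : (submoduleShortComplex N).ShortExact :=
  ModuleCat.shortComplex_shortExact _ (LinearMap.exact_subtype_mkQ N) N.injective_subtype
    N.mkQ_surjective

lemma nonempty_retract_radicalQuotient [IsArtinianRing Λ] (L : Type u) [AddCommGroup L]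
    [Module Λ L] [IsSimpleModule Λ L] :
    Nonempty (Retract (ModuleCat.of Λ L) (radicalQuotient Λ)) := by
  obtain ⟨I, hI, ⟨e⟩⟩ := isSimpleModule_iff_quot_maximal.1 ‹IsSimpleModule Λ L›
  let p : (Λ ⧸ Ring.jacobson Λ) →ₗ[Λ] L :=
    e.symm.toLinearMap ∘ₗ Submodule.factor (Ring.jacobson_le_of_isMaximal I)
  have hp : Function.Surjective p := e.symm.surjective.comp (Submodule.factor_surjective _)
  have : IsSemisimpleModule Λ (Λ ⧸ Ring.jacobson Λ) :=
    (IsArtinian.isSemisimpleModule_iff_jacobson Λ _).2 (Module.jacobson_quotient_jacobson Λ Λ)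
  obtain ⟨s, hs⟩ := IsSemisimpleModule.lifting_property p hp LinearMap.id
  exact ⟨⟨ModuleCat.ofHom s, ModuleCat.ofHom p, ModuleCat.hom_ext hs⟩⟩

lemma fg_induction [IsArtinianRing Λ] {Q : ∀ (M : ModuleCat.{u} Λ) [Module.Finite Λ M], Prop}
    (M : ModuleCat.{u} Λ) [Module.Finite Λ M] (top : Q (radicalQuotient Λ))
    (retract : ∀ {M N : ModuleCat.{u} Λ} [Module.Finite Λ M] [Module.Finite Λ N],
      Retract N M → Q M → Q N)
    (shortExact : ∀ {S : ShortComplex (ModuleCat.{u} Λ)} [Module.Finite Λ S.X₁]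
      [Module.Finite Λ S.X₂] [Module.Finite Λ S.X₃], S.ShortExact → Q S.X₁ → Q S.X₃ → Q S.X₂) :
    Q M := by
  suffices H : ∀ (M : Type u) [AddCommGroup M] [Module Λ M], IsFiniteLength Λ M →
      ∀ [Module.Finite Λ M], Q (ModuleCat.of Λ M) from
    H M (isFiniteLength_iff_isNoetherian_isArtinian.2 ⟨inferInstance, inferInstance⟩)
  intro M _ _ hM
  induction hM with
  | @of_subsingleton M =>
    intro _
    exact retract ⟨0, 0, by ext x; exact Subsingleton.elim (α := M) _ _⟩ top
  | @of_simple_quotient M _ _ N _ _ ih =>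
    intro _
    obtain ⟨ρ⟩ := nonempty_retract_radicalQuotient (Λ := Λ) (M ⧸ N)
    have : Module.Finite Λ (submoduleShortComplex N).X₁ := inferInstanceAs (Module.Finite Λ N)
    have : Module.Finite Λ (submoduleShortComplex N).X₂ := inferInstanceAs (Module.Finite Λ M)
    have : Module.Finite Λ (submoduleShortComplex N).X₃ := inferInstanceAs (Module.Finite Λ (M ⧸ N))
    exact shortExact (submoduleShortComplex_shortExact N) ih (retract ρ top)

lemma finite_X₂_of_exact [IsNoetherianRing Λ] {S : ShortComplex (ModuleCat.{u} Λ)} (hS : S.Exact)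
    (h₁ : Module.Finite Λ S.X₁) (h₃ : Module.Finite Λ S.X₃) : Module.Finite Λ S.X₂ := by
  rw [ShortComplex.ShortExact.moduleCat_exact_iff_function_exact] at hS
  have : IsNoetherian Λ S.X₂ := isNoetherian_of_range_eq_ker S.f.hom S.g.hom
    hS.linearMap_ker_eq.symm
  infer_instance

lemma exists_id_eq_sum_comp_of_projective (P : ModuleCat.{u} Λ) [Module.Finite Λ P]
    [Module.Projective Λ P] : ∃ (m : ℕ) (a : Fin m → (P ⟶ ModuleCat.of Λ Λ))
      (b : Fin m → (ModuleCat.of Λ Λ ⟶ P)), 𝟙 P = ∑ t, a t ≫ b t := by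
  obtain ⟨m, f, g, -, -, hfg⟩ := Module.Finite.exists_comp_eq_id_of_projective Λ P
  refine ⟨m, fun t => ModuleCat.ofHom (LinearMap.proj t ∘ₗ g),
    fun t => ModuleCat.ofHom (f ∘ₗ LinearMap.single Λ (fun _ => Λ) t), ?_⟩
  ext x
  have hx : f (g x) = x := LinearMap.congr_fun hfg x
  conv_lhs => rw [ModuleCat.hom_id, LinearMap.id_apply, ← hx, ← Finset.univ_sum_single (g x),
    map_sum]
  rw [ModuleCat.hom_sum, LinearMap.sum_apply]
  rfl

namespace ProjPres

variable [IsNoetherianRing Λ] {X : FGModuleCat.{u} Λ} (A : ProjPres X)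

/-- The sequence `0 → ΩX → P → X → 0` of a projective presentation. -/
abbrev shortComplex : ShortComplex (ModuleCat.{u} Λ) :=
  ShortComplex.mk A.ι.hom A.p.hom (congrArg (fun f => f.hom) A.ι_p)

lemma shortExact : A.shortComplex.ShortExact :=
  LinearMap.shortExact_shortComplexKer A.surj

end ProjPres

end FiniteModules

/-! ### The triangulated structure of the bounded derived category -/

section BoundedDerivedCategory

open Pretriangulated ZeroObject

variable {Λ : Type u} [Ring Λ] [HasDerivedCategory.{w} (ModuleCat.{u} Λ)]

instance [IsNoetherianRing Λ] : (isBoundedFG Λ).IsTriangulated where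
  exists_zero := by
    have isZero_homology (i : ℤ) : Limits.IsZero ((DerivedCategory.homologyFunctor _ i).obj
        (0 : DerivedCategory (ModuleCat.{u} Λ))) := Functor.map_isZero _ (Limits.isZero_zero _)
    refine ⟨0, Limits.isZero_zero _, ⟨0, 0, fun i _ => isZero_homology i⟩, fun i => ?_⟩
    have := ModuleCat.subsingleton_of_isZero (isZero_homology i)
    infer_instance
  ext₂' D hD h₁ h₃ := by
    refine ObjectProperty.le_isoClosure _ _ ?_
    obtain ⟨⟨a₁, b₁, h₁⟩, finite₁⟩ := h₁
    obtain ⟨⟨a₃, b₃, h₃⟩, finite₃⟩ := h₃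
    refine ⟨⟨min a₁ a₃, max b₁ b₃, fun i hi => ?_⟩, fun i => finite_X₂_of_exact
      (DerivedCategory.HomologySequence.exact₂ D hD i) (finite₁ i) (finite₃ i)⟩
    exact (DerivedCategory.HomologySequence.exact₂ D hD i).isZero_X₂
      ((h₁ i (by omega)).eq_of_src _ _) ((h₃ i (by omega)).eq_of_tgt _ _)

namespace BoundedDerivedCategory

section

variable {M N K : ModuleCat.{u} Λ} [Module.Finite Λ M] [Module.Finite Λ N] [Module.Finite Λ K]

/-- The morphism of stalk complexes in degree zero given by a linear map. -/
noncomputable def mapModule (f : M ⟶ N) : ofModule M ⟶ ofModule N :=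
  ObjectProperty.homMk ((DerivedCategory.singleFunctor (ModuleCat.{u} Λ) 0).map f)

lemma mapModule_id : mapModule (𝟙 M) = 𝟙 (ofModule M) := by
  ext
  exact (DerivedCategory.singleFunctor (ModuleCat.{u} Λ) 0).map_id M

lemma mapModule_comp (f : M ⟶ N) (g : N ⟶ K) :
    mapModule (f ≫ g) = mapModule f ≫ mapModule g := by
  ext
  exact (DerivedCategory.singleFunctor (ModuleCat.{u} Λ) 0).map_comp f g

lemma mapModule_sum {ι : Type*} (s : Finset ι) (f : ι → (M ⟶ N)) :
    mapModule (∑ i ∈ s, f i) = ∑ i ∈ s, mapModule (f i) := by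
  apply (isBoundedFG Λ).ι.map_injective
  rw [Functor.map_sum]
  exact (DerivedCategory.singleFunctor (ModuleCat.{u} Λ) 0).map_sum f s

/-- A direct summand of a module, as a direct summand in the bounded derived category. -/
noncomputable def retractOfModule (r : Retract M N) : Retract (ofModule M) (ofModule N) where
  i := mapModule r.i
  r := mapModule r.r
  retract := by rw [← mapModule_comp, r.retract, mapModule_id]

/-- `Hom(M, ΣⁿN) = Extⁿ(M, N)` in the bounded derived category. -/
noncomputable def shiftedHomEquivExt (n : ℕ) :
    ShiftedHom (ofModule M) (ofModule N) (n : ℤ) ≃ Ext.{u} M N n :=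
  (((isBoundedFG Λ).fullyFaithfulι.homEquiv (X := ofModule M)
    (Y := (ofModule N)⟦(n : ℤ)⟧)).trans
      (Iso.homToEquiv (((isBoundedFG Λ).ι.commShiftIso (n : ℤ)).app (ofModule N)))).trans
        Ext.homEquiv.symm

lemma subsingleton_ext_iff (n : ℕ) : Subsingleton (Ext.{u} M N n) ↔
    ∀ g : ShiftedHom (ofModule M) (ofModule N) (n : ℤ), g = 0 := by
  rw [← (shiftedHomEquivExt (M := M) (N := N) n).subsingleton_congr]
  exact ⟨fun _ g => Subsingleton.elim _ _, subsingleton_of_forall_eq 0⟩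

end

lemma exists_mapModule_distTriang [IsNoetherianRing Λ] {S : ShortComplex (ModuleCat.{u} Λ)}
    (hS : S.ShortExact) [Module.Finite Λ S.X₁] [Module.Finite Λ S.X₂] [Module.Finite Λ S.X₃] :
    ∃ δ : ofModule S.X₃ ⟶ (ofModule S.X₁)⟦(1 : ℤ)⟧,
      Triangle.mk (mapModule S.f) (mapModule S.g) δ ∈ distTriang (BoundedDerivedCategory Λ) := by
  let c := ((isBoundedFG Λ).ι.commShiftIso (1 : ℤ)).app (ofModule S.X₁)
  let δ : ofModule S.X₃ ⟶ (ofModule S.X₁)⟦(1 : ℤ)⟧ :=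
    (isBoundedFG Λ).fullyFaithfulι.preimage (hS.singleδ ≫ c.inv)
  have map_δ : (isBoundedFG Λ).ι.map δ = hS.singleδ ≫ c.inv :=
    (isBoundedFG Λ).fullyFaithfulι.map_preimage _
  have map_δ_comp : (isBoundedFG Λ).ι.map δ ≫ c.hom = hS.singleδ := by
    rw [map_δ]
    exact (Category.assoc _ _ _).trans
      ((congrArg (hS.singleδ ≫ ·) c.inv_hom_id).trans (Category.comp_id _))
  refine ⟨δ, isomorphic_distinguished _ hS.singleTriangle_distinguished _
    (Triangle.isoMk _ _ (Iso.refl _) (Iso.refl _) (Iso.refl _) ?_ ?_ ?_)⟩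
  · exact (Category.comp_id _).trans (Category.id_comp _).symm
  · exact (Category.comp_id _).trans (Category.id_comp _).symm
  · refine (congrArg (_ ≫ ·) (CategoryTheory.Functor.map_id _ _)).trans ?_
    exact (Category.comp_id _).trans (map_δ_comp.trans (Category.id_comp _).symm)

end BoundedDerivedCategory

end BoundedDerivedCategory

/-! ### Gaps in the vanishing of Ext -/

/-- `Extⁱ(M, N)` vanishes for all `i ≥ n`. -/
def ExtVanishesFrom {Λ : Type u} [Ring Λ] (M N : ModuleCat.{u} Λ) (n : ℕ) : Prop :=
  ∀ i : ℕ, n ≤ i → Subsingleton (Ext.{u} M N i)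

section Gap

open BoundedDerivedCategory Pretriangulated

variable {Λ : Type u} [Ring Λ] [HasDerivedCategory.{w} (ModuleCat.{u} Λ)]

lemma extVanishesFrom_iff_homVanishesFrom {M N : ModuleCat.{u} Λ} [Module.Finite Λ M]
    [Module.Finite Λ N] {n : ℕ} :
    ExtVanishesFrom M N n ↔ HomVanishesFrom (ofModule M) (ofModule N) n := by
  refine ⟨fun h i hi => ?_, fun h i hi => (subsingleton_ext_iff i).2 (h i (by omega))⟩
  obtain ⟨i, rfl⟩ := Int.eq_ofNat_of_zero_le ((Int.natCast_nonneg n).trans hi)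
  exact (subsingleton_ext_iff i).1 (h i (by omega))

namespace HomVanishesFrom

variable {X : BoundedDerivedCategory Λ} {a b : ℤ}

lemma ofModule_of_projective (h : HomVanishesFrom X (ofModule (ModuleCat.of Λ Λ)) a)
    (P : ModuleCat.{u} Λ) [Module.Finite Λ P] [Module.Projective Λ P] :
    HomVanishesFrom X (ofModule P) a := by
  obtain ⟨m, f, g, hfg⟩ := exists_id_eq_sum_comp_of_projective P
  refine h.of_id_eq_sum Finset.univ (fun t => mapModule (f t)) (fun t => mapModule (g t)) ?_
  rw [← mapModule_id, hfg, mapModule_sum]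
  exact Finset.sum_congr rfl fun t _ => mapModule_comp _ _

variable [IsArtinianRing Λ]

lemma ofModule_left {Y : BoundedDerivedCategory Λ}
    (h : HomVanishesFrom (ofModule (radicalQuotient Λ)) Y a) (M : ModuleCat.{u} Λ)
    [Module.Finite Λ M] : HomVanishesFrom (ofModule M) Y a := by
  refine fg_induction (Q := fun M _ => HomVanishesFrom (ofModule M) Y a) M h
    (fun r hM => hM.of_retract_left (retractOfModule r)) (fun hS h₁ h₃ => ?_)
  obtain ⟨δ, hD⟩ := exists_mapModule_distTriang hS
  exact of_distTriang_left hD h₁ h₃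

lemma ofModule_right (h : HomVanishesFrom X (ofModule (radicalQuotient Λ)) a)
    (N : ModuleCat.{u} Λ) [Module.Finite Λ N] : HomVanishesFrom X (ofModule N) a := by
  refine fg_induction (Q := fun N _ => HomVanishesFrom X (ofModule N) a) N h
    (fun r hN => hN.of_retract_right (retractOfModule r)) (fun hS h₁ h₃ => ?_)
  obtain ⟨δ, hD⟩ := exists_mapModule_distTriang hS
  exact of_distTriang_right hD h₁ h₃

/-- Projective presentations lower the bound one degree at a time, as long as there are no
morphisms to projective modules. -/
lemma ofModule_of_eventually (hX : HomVanishesFrom X (ofModule (radicalQuotient Λ)) b)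
    (hΛ : HomVanishesFrom X (ofModule (ModuleCat.of Λ Λ)) a) (N : ModuleCat.{u} Λ)
    [Module.Finite Λ N] : HomVanishesFrom X (ofModule N) a := by
  refine Int.leInductionDown (motive := fun c _ => a ≤ c → ∀ (N : ModuleCat.{u} Λ)
    [Module.Finite Λ N], HomVanishesFrom X (ofModule N) c)
    (fun _ N _ => (hX.ofModule_right N).mono (le_max_right a b)) (fun c _ ih hc N _ => ?_) a
    (le_max_left a b) le_rfl N
  let A := projPres (FGModuleCat.of Λ N)
  have := A.proj
  obtain ⟨δ, hD⟩ := exists_mapModule_distTriang A.shortExact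
  exact of_distTriang_obj₃_right hD
    ((ih (by omega) A.ker.obj).mono (by omega)) ((hΛ.mono hc).ofModule_of_projective A.P.obj)

end HomVanishesFrom

namespace CentralAction

variable [IsArtinianRing Λ] {R : Type*} [Ring R] {𝒜 : ℕ → AddSubgroup R} [GradedRing 𝒜]
  {act : CentralAction (BoundedDerivedCategory Λ) 𝒜}

lemma EventuallyNoetherian.of_radicalQuotient (h : act.EventuallyNoetherian
      (ofModule (radicalQuotient Λ)) (ofModule (radicalQuotient Λ)))
    (M N : ModuleCat.{u} Λ) [Module.Finite Λ M] [Module.Finite Λ N] :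
    act.EventuallyNoetherian (ofModule M) (ofModule N) := by
  have h_left : act.EventuallyNoetherian (ofModule M) (ofModule (radicalQuotient Λ)) := by
    refine fg_induction (Q := fun M _ => act.EventuallyNoetherian (ofModule M)
      (ofModule (radicalQuotient Λ))) M h
      (fun r hM => hM.of_retract_left (retractOfModule r)) (fun hS h₁ h₃ => ?_)
    obtain ⟨δ, hD⟩ := exists_mapModule_distTriang hS
    exact of_distTriang_left hD h₁ h₃
  refine fg_induction (Q := fun N _ => act.EventuallyNoetherian (ofModule M) (ofModule N)) N h_left
    (fun r hN => hN.of_retract_right (retractOfModule r)) (fun hS h₁ h₃ => ?_)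
  obtain ⟨δ, hD⟩ := exists_mapModule_distTriang hS
  exact of_distTriang_right hD h₁ h₃

theorem extVanishesFrom_of_eventually (hR : IsGradedCommutative 𝒜)
    (h : act.EventuallyNoetherian (ofModule (radicalQuotient Λ)) (ofModule (radicalQuotient Λ)))
    {M N : ModuleCat.{u} Λ} [Module.Finite Λ M] [Module.Finite Λ N] {a : ℕ}
    (hM : ExtVanishesFrom M (ModuleCat.of Λ Λ) a) (hMN : ∃ b, ExtVanishesFrom M N b) :
    ExtVanishesFrom M N a := by
  obtain ⟨b, hb⟩ := hMN
  have gap : ∀ a b : ℤ, HomVanishesFrom (ofModule M) (ofModule (ModuleCat.of Λ Λ)) a →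
      HomVanishesFrom (ofModule M) (ofModule N) b →
      HomVanishesFrom (ofModule M) (ofModule N) a :=
    (h.of_radicalQuotient M (radicalQuotient Λ)).cone_induction hR
      (Q := fun X => ∀ a b : ℤ, HomVanishesFrom X (ofModule (ModuleCat.of Λ Λ)) a →
        HomVanishesFrom X (ofModule N) b → HomVanishesFrom X (ofModule N) a)
      (fun K c hK a b ha _ => hK.ofModule_of_eventually ha N)
      (fun hn hD hK a b ha hb => hb.of_cone hn hD (hK _ _ (ha.cone hn hD) (hb.cone hn hD)))
  exact extVanishesFrom_iff_homVanishesFrom.2 (gap a b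
    (extVanishesFrom_iff_homVanishesFrom.1 hM) (extVanishesFrom_iff_homVanishesFrom.1 hb))

/-- Central elements of positive degree act as zero on `Ext^*(M, Λ)`, because `Extⁱ(Λ, Λ) = 0` for
`i > 0`; so this Noetherian module is bounded. -/
lemma exists_extVanishesFrom_self (hR : IsGradedCommutative 𝒜)
    (h : act.EventuallyNoetherian (ofModule (radicalQuotient Λ)) (ofModule (radicalQuotient Λ))) :
    ∃ n : ℕ, ∀ (M : ModuleCat.{u} Λ) [Module.Finite Λ M],
      ExtVanishesFrom M (ModuleCat.of Λ Λ) n := by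
  have ext_self : ExtVanishesFrom (ModuleCat.of Λ Λ) (ModuleCat.of Λ Λ) 1 := fun i hi =>
    have : Projective (ModuleCat.of Λ Λ) := ModuleCat.projective_of_categoryTheory_projective _
    HasProjectiveDimensionLT.subsingleton (ModuleCat.of Λ Λ) 1 i hi _
  obtain ⟨b, hb⟩ := h.of_radicalQuotient (radicalQuotient Λ) (ModuleCat.of Λ Λ)
  have := act.isNoetherian_evenHomGE (ofModule (radicalQuotient Λ)) (ofModule (.of Λ Λ)) hR b
  obtain ⟨a, ha⟩ := homVanishesFrom_of_le_radical_annihilator hR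
    ((act.evenIrrelevantIdeal_le_annihilator (ofModule (radicalQuotient Λ))
      (extVanishesFrom_iff_homVanishesFrom.1 ext_self) b).trans Ideal.le_radical)
  exact ⟨a.toNat, fun M _ => extVanishesFrom_iff_homVanishesFrom.2
    ((ha.mono (Int.self_le_toNat a)).ofModule_left M)⟩

end CentralAction

end Gap

/-! ### Dimension shifting and injective dimension -/

section DimensionShifting

variable {C : Type*} [Category C] [Abelian C] [HasExt.{w} C] {S : ShortComplex C}
  (hS : S.ShortExact) {Y : C}

include hS

lemma exists_extension_of_subsingleton_ext_one (h : Subsingleton (Ext.{w} S.X₃ Y 1))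
    (f : S.X₁ ⟶ Y) : ∃ g : S.X₂ ⟶ Y, S.f ≫ g = f := by
  obtain ⟨x, hx⟩ := Ext.contravariant_sequence_exact₁ hS Y (Ext.mk₀ f) (add_zero 1)
    (Subsingleton.elim _ _)
  obtain ⟨g, rfl⟩ := (Ext.mk₀_bijective S.X₂ Y).2 x
  rw [Ext.mk₀_comp_mk₀] at hx
  exact ⟨g, (Ext.mk₀_bijective S.X₁ Y).1 hx⟩

lemma subsingleton_ext_one_of_factors (h₂ : Subsingleton (Ext.{w} S.X₂ Y 1))
    (h : ∀ f : S.X₁ ⟶ Y, ∃ (Q : C) (a : S.X₁ ⟶ Q) (b : Q ⟶ Y),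
      Subsingleton (Ext.{w} S.X₃ Q 1) ∧ a ≫ b = f) : Subsingleton (Ext.{w} S.X₃ Y 1) := by
  refine subsingleton_of_forall_eq 0 fun x => ?_
  obtain ⟨y, rfl⟩ := Ext.contravariant_sequence_exact₃ hS Y x (h₂.elim _ _) (add_zero 1)
  obtain ⟨f, rfl⟩ := (Ext.mk₀_bijective S.X₁ Y).2 y
  obtain ⟨Q, a, b, hQ, rfl⟩ := h f
  rw [← Ext.mk₀_comp_mk₀, ← Ext.comp_assoc_of_third_deg_zero,
    hQ.elim (hS.extClass.comp (Ext.mk₀ a) (add_zero 1)) 0, Ext.zero_comp]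

variable {i : ℕ}

lemma subsingleton_ext_X₁_iff_X₃_left (h : Subsingleton (Ext.{w} S.X₂ Y i))
    (h' : Subsingleton (Ext.{w} S.X₂ Y (i + 1))) :
    Subsingleton (Ext.{w} S.X₁ Y i) ↔ Subsingleton (Ext.{w} S.X₃ Y (i + 1)) := by
  refine ⟨fun h₁ => subsingleton_of_forall_eq 0 fun x => ?_,
    fun h₃ => subsingleton_of_forall_eq 0 fun x => ?_⟩
  · obtain ⟨y, rfl⟩ := Ext.contravariant_sequence_exact₃ hS Y x (h'.elim _ _) (add_comm 1 i)
    rw [h₁.elim y 0, Ext.comp_zero]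
  · obtain ⟨y, rfl⟩ := Ext.contravariant_sequence_exact₁ hS Y x (add_comm 1 i) (h₃.elim _ _)
    rw [h.elim y 0, Ext.comp_zero]

lemma subsingleton_ext_X₁_iff_X₃_right (h : Subsingleton (Ext.{w} Y S.X₂ i))
    (h' : Subsingleton (Ext.{w} Y S.X₂ (i + 1))) :
    Subsingleton (Ext.{w} Y S.X₁ (i + 1)) ↔ Subsingleton (Ext.{w} Y S.X₃ i) := by
  refine ⟨fun h₁ => subsingleton_of_forall_eq 0 fun x => ?_,
    fun h₃ => subsingleton_of_forall_eq 0 fun x => ?_⟩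
  · obtain ⟨y, rfl⟩ := Ext.covariant_sequence_exact₃ Y hS x rfl (h₁.elim _ _)
    rw [h.elim y 0, Ext.zero_comp]
  · obtain ⟨y, rfl⟩ := Ext.covariant_sequence_exact₁ Y hS x (h'.elim _ _) rfl
    rw [h₃.elim y 0, Ext.zero_comp]

end DimensionShifting

section InjectiveDimension

variable {Λ : Type u} [Ring Λ]

lemma injective_of_subsingleton_ext_one_quotient (X : ModuleCat.{u} Λ)
    (h : ∀ I : Ideal Λ, Subsingleton (Ext.{u} (ModuleCat.of Λ (Λ ⧸ I)) X 1)) : Injective X := by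
  have : Module.Injective Λ X := by
    refine Module.Baer.injective fun I g => ?_
    obtain ⟨g', hg'⟩ := exists_extension_of_subsingleton_ext_one
      (submoduleShortComplex_shortExact I) (h I) (ModuleCat.ofHom g)
    exact ⟨g'.hom, fun x hx => congrArg (fun f : ModuleCat.of Λ I ⟶ X => f.hom ⟨x, hx⟩) hg'⟩
  exact Module.injective_object_of_injective_module Λ X

lemma hasInjectiveDimensionLT_of_subsingleton_ext_quotient (n : ℕ) (X : ModuleCat.{u} Λ)
    (h : ∀ I : Ideal Λ, Subsingleton (Ext.{u} (ModuleCat.of Λ (Λ ⧸ I)) X (n + 1))) :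
    HasInjectiveDimensionLT X (n + 1) := by
  induction n generalizing X with
  | zero =>
    have := injective_of_subsingleton_ext_one_quotient X h
    infer_instance
  | succ n ih =>
    have hS : (ShortComplex.mk (Injective.ι X) _ (Limits.cokernel.condition _)).ShortExact :=
      { exact := ShortComplex.exact_cokernel _ }
    refine (hS.hasInjectiveDimensionLT_X₃_iff n (inferInstanceAs (Injective (Injective.under X)))).1
      (ih _ fun I => ?_)
    exact (subsingleton_ext_X₁_iff_X₃_right hS (Ext.subsingleton_of_injective _ _ _)
      (Ext.subsingleton_of_injective _ _ _)).1 (h I)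

end InjectiveDimension

/-! ### Syzygies and extension groups -/

section Syzygy

variable {Λ : Type u} [Ring Λ]

lemma subsingleton_ext_of_projective_right {Z : ModuleCat.{u} Λ} {i : ℕ}
    (h : Subsingleton (Ext.{u} Z (ModuleCat.of Λ Λ) i)) (P : ModuleCat.{u} Λ) [Module.Finite Λ P]
    [Module.Projective Λ P] : Subsingleton (Ext.{u} Z P i) := by
  obtain ⟨m, a, b, hab⟩ := exists_id_eq_sum_comp_of_projective P
  refine subsingleton_of_forall_eq 0 fun x => ?_
  rw [← Ext.comp_mk₀_id x, hab, Ext.mk₀_sum, Ext.comp_sum]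
  refine Finset.sum_eq_zero fun t _ => ?_
  rw [← Ext.mk₀_comp_mk₀, ← Ext.comp_assoc_of_third_deg_zero,
    h.elim (x.comp (Ext.mk₀ (a t)) (add_zero i)) 0, Ext.zero_comp]

namespace ProjPres

variable {X : FGModuleCat.{u} Λ} (A : ProjPres X)

lemma subsingleton_ext_P_left (Y : ModuleCat.{u} Λ) {i : ℕ} (hi : 0 < i) :
    Subsingleton (Ext.{u} A.P.obj Y i) :=
  have := A.proj
  have : Projective A.P.obj := ModuleCat.projective_of_categoryTheory_projective _
  HasProjectiveDimensionLT.subsingleton A.P.obj 1 i hi Y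

lemma subsingleton_ext_P_right {Z : ModuleCat.{u} Λ} {i : ℕ}
    (hZ : Subsingleton (Ext.{u} Z (ModuleCat.of Λ Λ) i)) : Subsingleton (Ext.{u} Z A.P.obj i) :=
  have := A.proj
  subsingleton_ext_of_projective_right hZ A.P.obj

variable [IsNoetherianRing Λ]

lemma subsingleton_ext_ker_left_iff {Y : ModuleCat.{u} Λ} {i : ℕ} (hi : 0 < i) :
    Subsingleton (Ext.{u} A.ker.obj Y i) ↔ Subsingleton (Ext.{u} X.obj Y (i + 1)) :=
  subsingleton_ext_X₁_iff_X₃_left A.shortExact (A.subsingleton_ext_P_left Y hi)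
    (A.subsingleton_ext_P_left Y i.succ_pos)

lemma exists_extVanishesFrom_ker_right_iff {Z : ModuleCat.{u} Λ}
    (hZ : ∃ l, ExtVanishesFrom Z (ModuleCat.of Λ Λ) l) :
    (∃ m, ExtVanishesFrom Z A.ker.obj m) ↔ ∃ m, ExtVanishesFrom Z X.obj m := by
  obtain ⟨l, hl⟩ := hZ
  have ker_iff {i : ℕ} (hi : l ≤ i) :
      Subsingleton (Ext.{u} Z A.ker.obj (i + 1)) ↔ Subsingleton (Ext.{u} Z X.obj i) :=
    subsingleton_ext_X₁_iff_X₃_right A.shortExact (A.subsingleton_ext_P_right (hl i hi))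
      (A.subsingleton_ext_P_right (hl (i + 1) (by omega)))
  constructor
  · rintro ⟨m, hm⟩
    exact ⟨max l m, fun i hi => (ker_iff (by omega)).1 (hm (i + 1) (by omega))⟩
  · rintro ⟨m, hm⟩
    refine ⟨max l m + 1, fun i hi => ?_⟩
    obtain ⟨i, rfl⟩ := Nat.exists_eq_add_of_le' (show 1 ≤ i by omega)
    exact (ker_iff (by omega)).2 (hm i (by omega))

lemma factorsThroughProjective {Z : FGModuleCat.{u} Λ} (h : Subsingleton (Ext.{u} X.obj Z.obj 1))
    (f : A.ker ⟶ Z) : FactorsThroughProjective f := by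
  obtain ⟨g, hg⟩ := exists_extension_of_subsingleton_ext_one A.shortExact h f.hom
  exact ⟨A.P, A.ι, ObjectProperty.homMk g, A.proj, ObjectProperty.hom_ext _ hg⟩

lemma subsingleton_ext_one (hX : Subsingleton (Ext.{u} X.obj (ModuleCat.of Λ Λ) 1))
    {Z : FGModuleCat.{u} Λ} (h : ∀ f : A.ker ⟶ Z, FactorsThroughProjective f) :
    Subsingleton (Ext.{u} X.obj Z.obj 1) := by
  refine subsingleton_ext_one_of_factors A.shortExact (A.subsingleton_ext_P_left Z.obj one_pos)
    fun f => ?_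
  obtain ⟨Q, a, b, hQ, hab⟩ := h (ObjectProperty.homMk f)
  exact ⟨Q.obj, a.hom, b.hom, subsingleton_ext_of_projective_right hX Q.obj,
    congrArg (fun φ => φ.hom) hab⟩

end ProjPres

variable [IsNoetherianRing Λ]

/-- The syzygy `ΩX` of a finitely generated module, taken in the presentation chosen by `projPres`,
so that it is the value of `stableSyzygy Λ` on objects. -/
noncomputable def syzygy (X : FGModuleCat.{u} Λ) : FGModuleCat.{u} Λ :=
  (projPres X).ker

lemma subsingleton_ext_syzygy_left_iff (n : ℕ) {X : FGModuleCat.{u} Λ} {Y : ModuleCat.{u} Λ}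
    {i : ℕ} (hi : 0 < i) :
    Subsingleton (Ext.{u} (syzygy^[n] X).obj Y i) ↔ Subsingleton (Ext.{u} X.obj Y (i + n)) := by
  induction n generalizing i with
  | zero => rfl
  | succ n ih =>
    rw [Function.iterate_succ_apply', ← add_assoc, add_right_comm, ← ih i.succ_pos]
    exact (projPres _).subsingleton_ext_ker_left_iff hi

lemma ExtVanishesFrom.syzygy_left {X : FGModuleCat.{u} Λ} {Y : ModuleCat.{u} Λ} {a n : ℕ}
    (h : ExtVanishesFrom X.obj Y a) (han : a ≤ n + 1) :
    ExtVanishesFrom (syzygy^[n] X).obj Y 1 := fun i hi =>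
  (subsingleton_ext_syzygy_left_iff n hi).2 (h (i + n) (by omega))

lemma exists_extVanishesFrom_syzygy_left_iff (n : ℕ) {X : FGModuleCat.{u} Λ}
    {Y : ModuleCat.{u} Λ} :
    (∃ m, ExtVanishesFrom (syzygy^[n] X).obj Y m) ↔ ∃ m, ExtVanishesFrom X.obj Y m := by
  constructor
  · rintro ⟨m, hm⟩
    refine ⟨m + 1 + n, fun i hi => ?_⟩
    obtain ⟨i, rfl⟩ := Nat.exists_eq_add_of_le' (show n ≤ i by omega)
    exact (subsingleton_ext_syzygy_left_iff n (by omega)).1 (hm i (by omega))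
  · rintro ⟨m, hm⟩
    exact ⟨m + 1, fun i hi => (subsingleton_ext_syzygy_left_iff n (by omega)).2
      (hm (i + n) (by omega))⟩

lemma exists_extVanishesFrom_syzygy_right_iff (n : ℕ) {Z : ModuleCat.{u} Λ}
    {X : FGModuleCat.{u} Λ} (hZ : ∃ l, ExtVanishesFrom Z (ModuleCat.of Λ Λ) l) :
    (∃ m, ExtVanishesFrom Z (syzygy^[n] X).obj m) ↔ ∃ m, ExtVanishesFrom Z X.obj m := by
  induction n with
  | zero => rfl
  | succ n ih =>
    rw [Function.iterate_succ_apply', ← ih]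
    exact (projPres _).exists_extVanishesFrom_ker_right_iff hZ

end Syzygy

/-! ### Suspensions of syzygies in the stable category -/

section StableCategory

variable {Λ : Type u} [Ring Λ]

variable (Λ) in
/-- The projection from finitely generated modules to the stable category. -/
abbrev stableFunctor : FGModuleCat.{u} Λ ⥤ StableMod Λ :=
  CategoryTheory.Quotient.functor (stableRel Λ)

lemma stableFunctor_map_eq_zero_iff {X Y : FGModuleCat.{u} Λ} (f : X ⟶ Y) :
    (stableFunctor Λ).map f = 0 ↔ FactorsThroughProjective f := by
  rw [← Functor.map_zero (stableFunctor Λ) X Y, CategoryTheory.Quotient.functor_map_eq_iff]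
  change FactorsThroughProjective (f - 0) ↔ _
  rw [sub_zero]

lemma LeftApprox.Induced.map_eq_id {X : FGModuleCat.{u} Λ} {A : LeftApprox X}
    {h : A.coker ⟶ A.coker} (H : A.Induced A (𝟙 X) h) : (stableFunctor Λ).map h = 𝟙 _ := by
  rw [← CategoryTheory.Functor.map_id]
  exact H.sound (f' := 𝟙 X) ⟨𝟙 _, by simp, by simp⟩ (Congruence.equivalence.refl _)

lemma LeftApprox.nonempty_iso_coker {X : FGModuleCat.{u} Λ} (A B : LeftApprox X) :
    Nonempty ((stableFunctor Λ).obj A.coker ≅ (stableFunctor Λ).obj B.coker) := by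
  obtain ⟨f, hf⟩ := A.exists_induced B (𝟙 X)
  obtain ⟨g, hg⟩ := B.exists_induced A (𝟙 X)
  exact ⟨⟨(stableFunctor Λ).map f, (stableFunctor Λ).map g,
    (Functor.map_comp _ _ _).symm.trans (Category.comp_id (𝟙 X) ▸ hf.comp hg).map_eq_id,
    (Functor.map_comp _ _ _).symm.trans (Category.comp_id (𝟙 X) ▸ hg.comp hf).map_eq_id⟩⟩

variable [IsNoetherianRing Λ]

namespace ProjPres

variable {X : FGModuleCat.{u} Λ} (A : ProjPres X)

/-- The inclusion of the syzygy of `X` into the projective module of a presentation, as a left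
`add Λ`-approximation; this needs `Ext¹(X, Λ) = 0`. -/
noncomputable def leftApprox (hX : Subsingleton (Ext.{u} X.obj (ModuleCat.of Λ Λ) 1)) :
    LeftApprox A.ker where
  P := A.P
  proj := A.proj
  i := A.ι
  fac Q _ f := by
    obtain ⟨g, hg⟩ := exists_extension_of_subsingleton_ext_one A.shortExact
      (subsingleton_ext_of_projective_right hX Q.obj) f.hom
    exact ⟨ObjectProperty.homMk g, ObjectProperty.hom_ext _ hg⟩

lemma nonempty_coker_leftApprox_iso (hX : Subsingleton (Ext.{u} X.obj (ModuleCat.of Λ Λ) 1)) :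
    Nonempty ((A.leftApprox hX).coker ≅ X) := by
  have range_ι : LinearMap.range A.ι.hom.hom = LinearMap.ker A.p.hom.hom :=
    Submodule.range_subtype _
  exact ⟨ObjectProperty.isoMk _ ((Submodule.quotEquivOfEq _ _ range_ι).trans
    (A.p.hom.hom.quotKerEquivOfSurjective A.surj)).toModuleIso⟩

end ProjPres

variable (k : Type*) [CommRing k] [IsArtinianRing k] [Algebra k Λ] [Module.Finite k Λ]

lemma nonempty_stableSuspension_syzygy_iso {X : FGModuleCat.{u} Λ}
    (hX : Subsingleton (Ext.{u} X.obj (ModuleCat.of Λ Λ) 1)) :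
    Nonempty ((stableSuspension Λ k).obj ⟨syzygy X⟩ ≅ ⟨X⟩) := by
  obtain ⟨e⟩ := (leftApprox k (syzygy X)).nonempty_iso_coker ((projPres X).leftApprox hX)
  obtain ⟨e'⟩ := (projPres X).nonempty_coker_leftApprox_iso hX
  exact ⟨e ≪≫ (stableFunctor Λ).mapIso e'⟩

lemma nonempty_functorPow_stableSuspension_syzygy_iso {X : FGModuleCat.{u} Λ}
    (hX : ExtVanishesFrom X.obj (ModuleCat.of Λ Λ) 1) (n m : ℕ) :
    Nonempty ((functorPow (stableSuspension Λ k) n).obj ⟨syzygy^[n + m] X⟩ ≅ ⟨syzygy^[m] X⟩) := by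
  induction n generalizing m with
  | zero => rw [zero_add]; exact ⟨Iso.refl _⟩
  | succ n ih =>
    obtain ⟨e⟩ := ih (m + 1)
    obtain ⟨e'⟩ := nonempty_stableSuspension_syzygy_iso k
      (hX.syzygy_left (n := m) (by omega) 1 le_rfl)
    rw [Function.iterate_succ_apply' _ m] at e
    rw [show n + 1 + m = n + (m + 1) by omega]
    exact ⟨(stableSuspension Λ k).mapIso e ≪≫ e'⟩

lemma functorPow_stableSyzygy_obj (X : FGModuleCat.{u} Λ) (n : ℕ) :
    (functorPow (stableSyzygy Λ) n).obj ⟨X⟩ = ⟨syzygy^[n] X⟩ := by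
  induction n with
  | zero => rfl
  | succ n ih =>
    rw [Function.iterate_succ_apply']
    exact congrArg (stableSyzygy Λ).obj ih

lemma nonempty_stableShift_syzygy_iso {X : FGModuleCat.{u} Λ}
    (hX : ExtVanishesFrom X.obj (ModuleCat.of Λ Λ) 1) {d : ℤ} {i : ℕ} (hi : d ≤ i) :
    ∃ j : ℕ, Nonempty ((stableShift Λ k d).obj ⟨syzygy^[i] X⟩ ≅ ⟨syzygy^[j] X⟩) := by
  cases d with
  | ofNat n =>
    obtain ⟨j, rfl⟩ := Nat.exists_eq_add_of_le (Int.ofNat_le.1 hi)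
    exact ⟨j, nonempty_functorPow_stableSuspension_syzygy_iso k hX n j⟩
  | negSucc n =>
    refine ⟨n + 1 + i, ⟨eqToIso ?_⟩⟩
    rw [Function.iterate_add_apply]
    exact functorPow_stableSyzygy_obj _ (n + 1)

end StableCategory

section SerreDuality

lemma SerreFunctor.eq_zero_of_forall_eq_zero {k : Type*} [CommRing k] {E : Type*} [AddCommGroup E]
    [Module k E] {T : Type*} [Category T] [Preadditive T] [Linear k T] (F : SerreFunctor k E T)
    {X Y : T} (h : ∀ g : Y ⟶ F.S.obj X, g = 0) (f : X ⟶ Y) : f = 0 := by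
  refine (F.duality X Y).injective (LinearMap.ext fun g => ?_)
  rw [h g, map_zero, map_zero]

variable {Λ : Type u} [Ring Λ] [IsNoetherianRing Λ] {k : Type*} [CommRing k] [IsArtinianRing k]
  [Algebra k Λ] [Module.Finite k Λ] {E : Type*} [AddCommGroup E] [Module k E]

/-- Serre duality pairs `Hom(ΩⁱY, X)` with `Hom(X, ΣᵈΩⁱY)`, and `ΣᵈΩⁱY` is again a syzygy of `Y`
as soon as `i ≥ d`. -/
lemma IsStablySymmetric.exists_forall_factorsThroughProjective (hΛ : IsStablySymmetric Λ k E)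
    {X Y : FGModuleCat.{u} Λ} (hX : ExtVanishesFrom X.obj (ModuleCat.of Λ Λ) 1)
    (hY : ExtVanishesFrom Y.obj (ModuleCat.of Λ Λ) 1)
    (h : ∀ (j : ℕ) (f : X ⟶ syzygy^[j] Y), FactorsThroughProjective f) :
    ∃ n : ℕ, ∀ i, n ≤ i → ∀ f : syzygy^[i] Y ⟶ X, FactorsThroughProjective f := by
  obtain ⟨d, F, ⟨e⟩⟩ := hΛ
  refine ⟨d.toNat, fun i hi f => ?_⟩
  let X' : StableMCM Λ := ⟨⟨X⟩, hX⟩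
  let Y' : StableMCM Λ := ⟨⟨syzygy^[i] Y⟩, hY.syzygy_left (by omega)⟩
  obtain ⟨j, ⟨e'⟩⟩ := nonempty_stableShift_syzygy_iso k hY (Int.toNat_le.1 hi)
  have hom_syzygy_eq_zero (g : X'.obj ⟶ ⟨syzygy^[j] Y⟩) : g = 0 := by
    obtain ⟨φ, rfl⟩ := (stableFunctor Λ).map_surjective (X := X) (Y := syzygy^[j] Y) g
    exact (stableFunctor_map_eq_zero_iff φ).2 (h j φ)
  have hom_serre_eq_zero (g : X' ⟶ F.S.obj Y') : g = 0 :=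
    ObjectProperty.hom_ext _ <| (cancel_mono (e.app Y' ≪≫ e').hom).1 <|
      (hom_syzygy_eq_zero _).trans Limits.zero_comp.symm
  exact (stableFunctor_map_eq_zero_iff f).1 (congrArg (fun φ => φ.hom)
    (F.eq_zero_of_forall_eq_zero hom_serre_eq_zero
      (ObjectProperty.homMk ((stableFunctor Λ).map f) : Y' ⟶ X')))

end SerreDuality

/-! ### Symmetry of the vanishing of Ext -/

section Symmetry

open BoundedDerivedCategory

variable {Λ : Type u} [Ring Λ]

/-- Since `Ext¹(ΩⁱY, X)` is a quotient of `Hom(Ωⁱ⁺¹Y, X)`. -/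
lemma extVanishesFrom_of_factorsThroughProjective [IsNoetherianRing Λ] {X Y : FGModuleCat.{u} Λ}
    (hY : ExtVanishesFrom Y.obj (ModuleCat.of Λ Λ) 1) {n : ℕ}
    (h : ∀ i, n ≤ i → ∀ f : syzygy^[i] Y ⟶ X, FactorsThroughProjective f) :
    ExtVanishesFrom Y.obj X.obj (n + 1) := by
  intro i hi
  obtain ⟨i, rfl⟩ := Nat.exists_eq_add_of_le (show 1 ≤ i by omega)
  refine (subsingleton_ext_syzygy_left_iff i one_pos).1 ?_
  refine (projPres _).subsingleton_ext_one (hY.syzygy_left (by omega) 1 le_rfl) fun f => ?_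
  have factors := h (i + 1) (by omega)
  rw [Function.iterate_succ_apply'] at factors
  exact factors f

variable [IsArtinianRing Λ] [HasDerivedCategory.{w} (ModuleCat.{u} Λ)]
  {R : Type*} [Ring R] {𝒜 : ℕ → AddSubgroup R} [GradedRing 𝒜]
  {act : CentralAction (BoundedDerivedCategory Λ) 𝒜}

namespace CentralAction

lemma exists_hasInjectiveDimensionLT (hR : IsGradedCommutative 𝒜)
    (h : act.EventuallyNoetherian (ofModule (radicalQuotient Λ)) (ofModule (radicalQuotient Λ))) :
    ∃ n : ℕ, HasInjectiveDimensionLT (ModuleCat.of Λ Λ) n := by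
  obtain ⟨n, hn⟩ := exists_extVanishesFrom_self hR h
  exact ⟨n + 1, hasInjectiveDimensionLT_of_subsingleton_ext_quotient n _
    fun I => hn (ModuleCat.of Λ (Λ ⧸ I)) (n + 1) (by omega)⟩

theorem exists_extVanishesFrom_iff_forall_injectiveDimension_lt (hR : IsGradedCommutative 𝒜)
    (h : act.EventuallyNoetherian (ofModule (radicalQuotient Λ)) (ofModule (radicalQuotient Λ)))
    (M N : ModuleCat.{u} Λ) [Module.Finite Λ M] [Module.Finite Λ N] :
    (∃ n, ExtVanishesFrom M N n) ↔ ∀ i : ℕ,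
      injectiveDimension (ModuleCat.of Λ Λ) < (i : WithBot ℕ∞) → Subsingleton (Ext.{u} M N i) := by
  constructor
  · intro hMN a ha
    have := injectiveDimension_lt_iff.1 ha
    exact extVanishesFrom_of_eventually hR h
      (fun i hi => HasInjectiveDimensionLT.subsingleton _ a i hi M) hMN a le_rfl
  · intro hMN
    obtain ⟨d, hd⟩ := exists_hasInjectiveDimensionLT hR h
    exact ⟨d, fun i hi => hMN i <| injectiveDimension_lt_iff.2 <|
      hasInjectiveDimensionLT_of_ge _ d i hi⟩

end CentralAction

namespace IsStablySymmetric

variable {k : Type*} [CommRing k] [IsArtinianRing k] [Algebra k Λ] [Module.Finite k Λ]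
  {E : Type*} [AddCommGroup E] [Module k E]

lemma exists_extVanishesFrom_symm_of_isMCM (hΛ : IsStablySymmetric Λ k E)
    (hR : IsGradedCommutative 𝒜)
    (h : act.EventuallyNoetherian (ofModule (radicalQuotient Λ)) (ofModule (radicalQuotient Λ)))
    {X Y : FGModuleCat.{u} Λ} (hX : ExtVanishesFrom X.obj (ModuleCat.of Λ Λ) 1)
    (hY : ExtVanishesFrom Y.obj (ModuleCat.of Λ Λ) 1) (hXY : ∃ n, ExtVanishesFrom X.obj Y.obj n) :
    ∃ n, ExtVanishesFrom Y.obj X.obj n := by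
  have ext_syzygy (j : ℕ) : ExtVanishesFrom X.obj (syzygy^[j] Y).obj 1 :=
    CentralAction.extVanishesFrom_of_eventually hR h hX
      ((exists_extVanishesFrom_syzygy_right_iff j ⟨1, hX⟩).2 hXY)
  obtain ⟨n, hn⟩ := hΛ.exists_forall_factorsThroughProjective (hX.syzygy_left (n := 1) (by omega))
    hY fun j f => (projPres X).factorsThroughProjective (ext_syzygy j 1 le_rfl) f
  exact (exists_extVanishesFrom_syzygy_right_iff 1 ⟨1, hY⟩).1
    ⟨n + 1, extVanishesFrom_of_factorsThroughProjective hY hn⟩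

theorem exists_extVanishesFrom_symm (hΛ : IsStablySymmetric Λ k E) (hR : IsGradedCommutative 𝒜)
    (h : act.EventuallyNoetherian (ofModule (radicalQuotient Λ)) (ofModule (radicalQuotient Λ)))
    (M N : FGModuleCat.{u} Λ) (hMN : ∃ n, ExtVanishesFrom M.obj N.obj n) :
    ∃ n, ExtVanishesFrom N.obj M.obj n := by
  obtain ⟨d, hd⟩ := CentralAction.exists_extVanishesFrom_self hR h
  have isMCM_syzygy (X : FGModuleCat.{u} Λ) :
      ExtVanishesFrom (syzygy^[d] X).obj (ModuleCat.of Λ Λ) 1 := (hd X.obj).syzygy_left (by omega)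
  have symm_syzygy := hΛ.exists_extVanishesFrom_symm_of_isMCM hR h
    (isMCM_syzygy M) (isMCM_syzygy N)
  rwa [exists_extVanishesFrom_syzygy_right_iff d ⟨1, isMCM_syzygy M⟩,
    exists_extVanishesFrom_syzygy_left_iff, exists_extVanishesFrom_syzygy_right_iff d
    ⟨1, isMCM_syzygy N⟩, exists_extVanishesFrom_syzygy_left_iff, imp_iff_right hMN] at symm_syzygy

end IsStablySymmetric

end Symmetry

theorem mainTheorem3_general
    {k : Type*} [CommRing k] [IsArtinianRing k]
    {Λ : Type u} [Ring Λ] [Algebra k Λ] [Module.Finite k Λ]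
    [HasDerivedCategory.{w} (ModuleCat.{u} Λ)]
    {E : Type*} [AddCommGroup E] [Module k E] (hΛ : IsStablySymmetric Λ k E)
    {R : Type*} [Ring R] {𝒜 : ℕ → AddSubgroup R} [GradedRing 𝒜] (hR : IsGradedCommutative 𝒜)
    {act : CentralAction (BoundedDerivedCategory Λ) 𝒜}
    (h : act.EventuallyNoetherian (BoundedDerivedCategory.ofModule (radicalQuotient Λ))
      (BoundedDerivedCategory.ofModule (radicalQuotient Λ)))
    (M N : ModuleCat.{u} Λ) [Module.Finite Λ M] [Module.Finite Λ N] :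
    List.TFAE [
      ∃ n : ℕ, ∀ i : ℕ, n ≤ i → Subsingleton (Ext.{u} M N i),
      ∀ i : ℕ, injectiveDimension (ModuleCat.of Λ Λ) < (i : WithBot ℕ∞) →
        Subsingleton (Ext.{u} M N i),
      ∃ n : ℕ, ∀ i : ℕ, n ≤ i → Subsingleton (Ext.{u} N M i),
      ∀ i : ℕ, injectiveDimension (ModuleCat.of Λ Λ) < (i : WithBot ℕ∞) →
        Subsingleton (Ext.{u} N M i)] := by
  have : IsArtinianRing Λ := isArtinian_of_tower k (inferInstance : IsArtinian k Λ)
  tfae_have 1 ↔ 2 :=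
    CentralAction.exists_extVanishesFrom_iff_forall_injectiveDimension_lt hR h M N
  tfae_have 3 ↔ 4 :=
    CentralAction.exists_extVanishesFrom_iff_forall_injectiveDimension_lt hR h N M
  tfae_have 1 → 3 := hΛ.exists_extVanishesFrom_symm hR h ⟨M, ‹_›⟩ ⟨N, ‹_›⟩
  tfae_have 3 → 1 := hΛ.exists_extVanishesFrom_symm hR h ⟨N, ‹_›⟩ ⟨M, ‹_›⟩
  tfae_finish

theorem mainTheorem3
    {k : Type*} [CommRing k] [IsArtinianRing k]
    {Λ : Type u} [Ring Λ] [Algebra k Λ] [Module.Finite k Λ]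
    [HasDerivedCategory.{w} (ModuleCat.{u} Λ)]
    (E : Type*) [AddCommGroup E] [Module k E]
    (hE : ∀ m : Ideal k, m.IsMaximal → ∃ f : (k ⧸ m) →ₗ[k] E, Function.Injective f)
    (hΛ : IsStablySymmetric Λ k E)
    {R : Type*} [Ring R] (𝒜 : ℕ → AddSubgroup R) [GradedRing 𝒜] (hR : IsGradedCommutative 𝒜)
    (act : CentralAction (BoundedDerivedCategory Λ) 𝒜)
    (hfin : act.IsEventuallyNoetherianOfFiniteLength
      (BoundedDerivedCategory.ofModule (ModuleCat.of Λ (Λ ⧸ Ring.jacobson Λ)))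
      (BoundedDerivedCategory.ofModule (ModuleCat.of Λ (Λ ⧸ Ring.jacobson Λ))))
    (M N : ModuleCat.{u} Λ) [Module.Finite Λ M] [Module.Finite Λ N] :
    List.TFAE [
      ∃ n : ℕ, ∀ i : ℕ, n ≤ i → Subsingleton (Ext.{u} M N i),
      ∀ i : ℕ, injectiveDimension (ModuleCat.of Λ Λ) < (i : WithBot ℕ∞) →
        Subsingleton (Ext.{u} M N i),
      ∃ n : ℕ, ∀ i : ℕ, n ≤ i → Subsingleton (Ext.{u} N M i),
      ∀ i : ℕ, injectiveDimension (ModuleCat.of Λ Λ) < (i : WithBot ℕ∞) →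
        Subsingleton (Ext.{u} N M i)] :=
  mainTheorem3_general hΛ hR hfin.1 M N
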